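/- Let $n\ge 1$, $p>1$, $0<\beta<2$, and let $f:\mathbb R\to\mathbb R$ satisfy $f(0)=0$ and $$|f(a)-f(b)|\le C|a-b|\left(e^{\lambda|a|^p}+e^{\lambda|b|^p}\right)\qquad\text{for all }a,b\in\mathbb R,$$ for some constants $C>0$, $\lambda>0$. Let $\exp L^p(\mathbb R^n)$ be the space of all $u\in L^1_{loc}(\mathbb R^n)$ (functions being identified when equal almost everywhere) such that $\int_{\mathbb R^n}\left(e^{|u(x)|^p/l^p}-1\right)dx<\infty$ for some $l>0$, with the Luxemburg norm $$\|u\|_{\exp L^p}=\inf\Big\{l>0:\ \int_{\mathbb R^n}\left(e^{|u(x)|^p/l^p}-1\right)dx\le 1\Big\},$$ and let $\exp L^p_0(\mathbb R^n)$ be the closure of $C_0^\infty(\mathbb R^n)$ in it. For $t>0$ put $$S_\beta(x,t)=\frac1{(2\pi)^n}\int_{\mathbb R^n}e^{ix\cdot\xi-t|\xi|^\beta}\,d\xi,\qquad e^{-t(-\Delta)^{\beta/2}}g=S_\beta(\cdot,t)*g,$$ and let $e^{-t(-\Delta)^{\beta/2}}$ be the identity for $t=0$. Given $u_0\in\exp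 L^p_0(\mathbb R^n)$ and $T>0$, a mild solution on $[0,T]$ of $$u_t+(-\Delta)^{\beta/2}u=f(u),\qquad u(0)=u_0,$$ is a function $u\in C([0,T];\exp L^p_0(\mathbb R^n))$ such that for every $t\in[0,T]$, almost everywhere in $\mathbb R^n$ and with absolutely convergent time integral, $$u(t)=e^{-t(-\Delta)^{\beta/2}}u_0+\int_0^t e^{-(t-s)(-\Delta)^{\beta/2}}f(u(s))\,ds .$$ Then for every $u_0\in\exp L^p_0(\mathbb R^n)$ there exists $T=T(u_0)>0$ such that this problem has exactly one mild solution $u\in C([0,T];\exp L^p_0(\mathbb R^n))$ on $[0,T]$. -/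

import Mathlib

noncomputable section

namespace FracHeat

open MeasureTheory Filter Topology Set
open scoped ENNReal

/-- `ℝⁿ` with its Euclidean norm. -/
abbrev E (n : ℕ) : Type := EuclideanSpace ℝ (Fin n)

/-- Real measurable functions on `ℝⁿ` up to Lebesgue-a.e. equality. -/
abbrev Fn (n : ℕ) : Type := E n →ₘ[(volume : Measure (E n))] ℝ

/-- The modular `∫ (exp (|u|^p / l^p) - 1) dx`, as a number in `[0, ∞]`. -/
def modular {n : ℕ} (p : ℝ) (u : E n → ℝ) (l : ℝ) : ℝ≥0∞ :=
  ∫⁻ x, ENNReal.ofReal (Real.exp (|u x| ^ p / l ^ p) - 1)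

/-- The Luxemburg norm of `exp L^p`; it is `∞` when no admissible `l` exists. -/
def luxNorm {n : ℕ} (p : ℝ) (u : E n → ℝ) : ℝ≥0∞ :=
  ⨅ (l : ℝ) (_ : 0 < l) (_ : modular p u l ≤ 1), ENNReal.ofReal l

/-- The Orlicz space `exp L^p(ℝⁿ)`. -/
def expL (n : ℕ) (p : ℝ) : Set (Fn n) :=
  {u | LocallyIntegrable u ∧ ∃ l : ℝ, 0 < l ∧ modular p u l < ⊤}

/-- The closure `exp L^p_0(ℝⁿ)` of the smooth compactly supported functions in `exp L^p(ℝⁿ)`. -/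
def expLZero (n : ℕ) (p : ℝ) : Set (Fn n) :=
  {u | u ∈ expL n p ∧ ∃ φ : ℕ → E n → ℝ,
    (∀ k, ContDiff ℝ ((⊤ : ℕ∞) : WithTop ℕ∞) (φ k) ∧ HasCompactSupport (φ k)) ∧
    Tendsto (fun k => luxNorm p (fun x => φ k x - u x)) atTop (𝓝 0)}

/-- The fundamental solution
`S_β(x,t) = (2π)^{-n} ∫ exp (i x·ξ - t |ξ|^β) dξ`, for `t > 0`. The integral is a real number
(the integrand at `-ξ` is the conjugate of the integrand at `ξ`), so taking the real part only
changes its type. -/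
def kernel {n : ℕ} (β t : ℝ) (x : E n) : ℝ :=
  ((2 * Real.pi) ^ n)⁻¹ *
    (∫ ξ : E n, Complex.exp (Complex.I * ((inner ℝ x ξ : ℝ) : ℂ) -
      ((t * ‖ξ‖ ^ β : ℝ) : ℂ))).re

/-- The semigroup `e^{-t(-Δ)^{β/2}} g`, evaluated at `x`: convolution with the fundamental
solution for `t > 0`, the identity at `t = 0`. -/
def semigroup {n : ℕ} (β t : ℝ) (g : E n → ℝ) (x : E n) : ℝ :=
  if t = 0 then g x else ∫ y : E n, kernel β t (x - y) * g y

/-- `u ∈ C([0,T]; exp L^p_0(ℝⁿ))` (only the values `u t` for `t ∈ [0,T]` matter). -/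
structure IsContinuousCurve {n : ℕ} (p T : ℝ) (u : ℝ → Fn n) : Prop where
  mem : ∀ t ∈ Icc 0 T, u t ∈ expLZero n p
  cont : ∀ t₀ ∈ Icc 0 T,
    Tendsto (fun t => luxNorm p (fun x => u t x - u t₀ x)) (𝓝[Icc 0 T] t₀) (𝓝 0)

/-- `u` is a mild solution on `[0,T]` of `u_t + (-Δ)^{β/2} u = f(u)`, `u(0) = u₀`: it is a
continuous curve in `exp L^p_0(ℝⁿ)`, and for every `t ∈ [0,T]` the Duhamel formula holds a.e. in
`ℝⁿ`, the time integral being absolutely convergent. -/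
structure IsMildSolution {n : ℕ} (p β : ℝ) (f : ℝ → ℝ) (u₀ : Fn n) (T : ℝ)
    (u : ℝ → Fn n) : Prop where
  curve : IsContinuousCurve p T u
  duhamel : ∀ t ∈ Icc 0 T, ∀ᵐ x : E n,
    IntervalIntegrable (fun s => semigroup β (t - s) (fun y => f (u s y)) x) volume 0 t ∧
    u t x = semigroup β t u₀ x + ∫ s in (0 : ℝ)..t, semigroup β (t - s) (fun y => f (u s y)) x

end FracHeat

end

/-!
The function `exp (-|ξ|^β)` is a limit of functions `φ (c_k ξ)^k`, where `φ` is a mixture of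
Gaussians `exp (-s |ξ|^2)` with `s` Pareto distributed, so its inverse Fourier transform is
nonnegative. Hence the semigroup `S(t)` averages over the translates by `t^(1/β) z`, where `z` has a
fixed law with bounded density. By Jensen's inequality these averages do not increase
`∫ (exp (μ |u|^p) - 1)`, and by the bound on the density `|S(t) f(u)| ≤ Λ t^(-θ)` for `t ≤ 1`, with
`θ = n / (β q)` made less than one by a choice of `q` that is paid for in the exponential
integrability of `u`.

Elements of `exp L^p_0` have finite exponential integrals at every rate `μ`. Hence the solution can
be sought as `S(t) u₀ + w(t)` with `|w| ≤ 1` and `∫ |w(t)|^p ≤ 1`: a uniform bound on the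
exponential integrals of such functions makes `f` Lipschitz after averaging, and the Duhamel map is
a contraction in the uniform norm once `T` is small. Uniqueness holds because the difference of two
mild solutions is bounded and the Duhamel map contracts the uniform norm weighted by
`exp (-γ t)`, for `γ` large.
-/

noncomputable section

namespace FracHeat

open MeasureTheory ProbabilityTheory Filter Topology Set Module
open scoped ENNReal NNReal BoundedContinuousFunction

/-! ### Positivity of the stable kernel -/

section CosineTransform

lemma abs_cos_mul_le (a b : ℝ) : |Real.cos a * b| ≤ |b| := by
  rw [abs_mul]
  exact mul_le_of_le_one_left (abs_nonneg b) (Real.abs_cos_le_one a)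

variable {V : Type*} [NormedAddCommGroup V] [InnerProductSpace ℝ V] [FiniteDimensional ℝ V]
  [MeasurableSpace V] [BorelSpace V]

lemma integrable_gaussian {δ : ℝ} (hδ : 0 < δ) :
    Integrable (fun ξ : V => Real.exp (-δ * ‖ξ‖ ^ 2)) := by
  have h := (GaussianFourier.integrable_cexp_neg_mul_sq_norm_add (V := V) (b := (δ : ℂ))
    (by simpa using hδ) 0 0).re
  refine h.congr (Eventually.of_forall fun ξ => ?_)
  simp [Complex.exp_re, ← Complex.ofReal_pow]

lemma integral_cos_inner_mul_gaussian {δ : ℝ} (hδ : 0 < δ) (x : V) :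
    ∫ ξ : V, Real.cos (inner ℝ x ξ) * Real.exp (-δ * ‖ξ‖ ^ 2) =
      (Real.pi / δ) ^ (finrank ℝ V / 2 : ℝ) * Real.exp (-‖x‖ ^ 2 / (4 * δ)) := by
  have hb : 0 < ((δ : ℂ)).re := by simpa using hδ
  have h := congrArg Complex.re
    (GaussianFourier.integral_cexp_neg_mul_sq_norm_add (V := V) hb Complex.I x)
  have hre := Complex.reCLM.integral_comp_comm
    (GaussianFourier.integrable_cexp_neg_mul_sq_norm_add (V := V) hb Complex.I x)
  simp only [Complex.reCLM_apply] at hre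
  rw [← hre] at h
  have hrhs : ((Real.pi : ℂ) / δ) ^ ((finrank ℝ V : ℂ) / 2) *
      Complex.exp (Complex.I ^ 2 * (‖x‖ : ℂ) ^ 2 / (4 * δ)) =
      (((Real.pi / δ) ^ (finrank ℝ V / 2 : ℝ) * Real.exp (-‖x‖ ^ 2 / (4 * δ)) : ℝ) : ℂ) := by
    rw [Complex.ofReal_mul, Complex.ofReal_cpow (by positivity)]
    push_cast
    simp
  rw [hrhs, Complex.ofReal_re] at h
  rw [← h]
  refine integral_congr_ae (Eventually.of_forall fun ξ => ?_)
  simp [Complex.exp_re, ← Complex.ofReal_pow, mul_comm]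

lemma integrable_cos_inner_mul (x : V) {g : V → ℝ} (hg : Integrable g) :
    Integrable (fun ξ : V => Real.cos (inner ℝ x ξ) * g ξ) :=
  hg.bdd_mul (c := 1) (Continuous.aestronglyMeasurable (by fun_prop))
    (Eventually.of_forall fun _ => Real.abs_cos_le_one _)

/-- Measurable functions bounded by one whose product with every centred Gaussian has a
nonnegative cosine transform: the even, real-valued characteristic functions of probability
measures, in a form that needs no such measure to be constructed. -/
structure CosPositive (h : V → ℝ) : Prop where
  measurable : Measurable h
  abs_le_one : ∀ ξ, |h ξ| ≤ 1
  nonneg : ∀ δ : ℝ, 0 < δ → ∀ x : V,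
    0 ≤ ∫ ξ, Real.cos (inner ℝ x ξ) * (h ξ * Real.exp (-δ * ‖ξ‖ ^ 2))

namespace CosPositive

lemma integrable_mul_gaussian {h : V → ℝ} (hh : CosPositive h) {δ : ℝ} (hδ : 0 < δ) :
    Integrable (fun ξ => h ξ * Real.exp (-δ * ‖ξ‖ ^ 2)) :=
  (integrable_gaussian hδ).bdd_mul hh.measurable.aestronglyMeasurable
    (Eventually.of_forall hh.abs_le_one)

lemma one : CosPositive (fun _ : V => 1) where
  measurable := measurable_const
  abs_le_one := by simp
  nonneg δ hδ x := by
    simp only [one_mul]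
    rw [integral_cos_inner_mul_gaussian hδ]
    positivity

lemma of_tendsto {h : ℕ → V → ℝ} {g : V → ℝ} (hh : ∀ k, CosPositive (h k))
    (hlim : ∀ ξ, Tendsto (fun k => h k ξ) atTop (𝓝 (g ξ))) : CosPositive g where
  measurable := measurable_of_tendsto_metrizable (fun k => (hh k).measurable)
    (tendsto_pi_nhds.2 hlim)
  abs_le_one ξ := le_of_tendsto' (hlim ξ).abs fun k => (hh k).abs_le_one ξ
  nonneg δ hδ x := by
    refine ge_of_tendsto' (x := atTop) ?_ fun k => (hh k).nonneg δ hδ x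
    refine tendsto_integral_of_dominated_convergence (fun ξ => Real.exp (-δ * ‖ξ‖ ^ 2))
      (fun k => (integrable_cos_inner_mul x
        ((hh k).integrable_mul_gaussian hδ)).aestronglyMeasurable)
      (integrable_gaussian hδ) (fun k => Eventually.of_forall fun ξ => ?_)
      (Eventually.of_forall fun ξ => ((hlim ξ).mul_const _).const_mul _)
    refine (abs_cos_mul_le _ _).trans ?_
    rw [abs_mul, Real.abs_exp]
    exact mul_le_of_le_one_left (Real.exp_pos _).le ((hh k).abs_le_one ξ)

lemma integral_cos_inner_mul_nonneg {h : V → ℝ} (hh : CosPositive h) (hint : Integrable h)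
    (x : V) : 0 ≤ ∫ ξ, Real.cos (inner ℝ x ξ) * h ξ := by
  have hlim : Tendsto (fun δ : ℝ => ∫ ξ, Real.cos (inner ℝ x ξ) *
      (h ξ * Real.exp (-δ * ‖ξ‖ ^ 2))) (𝓝[>] 0) (𝓝 (∫ ξ, Real.cos (inner ℝ x ξ) * h ξ)) := by
    refine tendsto_integral_filter_of_dominated_convergence (fun ξ => |h ξ|)
      (Eventually.of_forall fun δ => ?_) ?_ hint.abs (Eventually.of_forall fun ξ => ?_)
    · have := hh.measurable
      exact Measurable.aestronglyMeasurable (by fun_prop)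
    · filter_upwards [self_mem_nhdsWithin] with δ (hδ : 0 < δ)
      refine Eventually.of_forall fun ξ => ?_
      refine (abs_cos_mul_le _ _).trans ?_
      rw [abs_mul, Real.abs_exp]
      exact mul_le_of_le_one_right (abs_nonneg _)
        (Real.exp_le_one_iff.2 (by nlinarith [sq_nonneg ‖ξ‖]))
    · have hcont : Continuous fun δ : ℝ =>
          Real.cos (inner ℝ x ξ) * (h ξ * Real.exp (-δ * ‖ξ‖ ^ 2)) := by fun_prop
      simpa using (hcont.tendsto 0).mono_left nhdsWithin_le_nhds
  refine ge_of_tendsto hlim ?_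
  filter_upwards [self_mem_nhdsWithin] with δ hδ using hh.nonneg δ hδ x

lemma mul_integral_gaussian {h : V → ℝ} (hh : CosPositive h) {ν : Measure ℝ}
    [IsProbabilityMeasure ν] (hν : ∀ᵐ s ∂ν, 0 ≤ s) :
    CosPositive (fun ξ => h ξ * ∫ s, Real.exp (-s * ‖ξ‖ ^ 2) ∂ν) where
  measurable := by
    have hm : StronglyMeasurable fun q : V × ℝ => Real.exp (-q.2 * ‖q.1‖ ^ 2) :=
      Measurable.stronglyMeasurable (by fun_prop)
    exact hh.measurable.mul hm.integral_prod_right.measurable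
  abs_le_one ξ := by
    have hle : ‖∫ s, Real.exp (-s * ‖ξ‖ ^ 2) ∂ν‖ ≤ 1 := by
      refine (norm_integral_le_of_norm_le_const (C := 1) ?_).trans_eq (by simp)
      filter_upwards [hν] with s hs
      rw [Real.norm_eq_abs, Real.abs_exp, Real.exp_le_one_iff]
      nlinarith [mul_nonneg hs (sq_nonneg ‖ξ‖)]
    rw [abs_mul]
    exact mul_le_one₀ (hh.abs_le_one ξ) (abs_nonneg _) hle
  nonneg δ hδ x := by
    have hfubini : ∀ ξ : V, Real.cos (inner ℝ x ξ) *
        (h ξ * (∫ s, Real.exp (-s * ‖ξ‖ ^ 2) ∂ν) * Real.exp (-δ * ‖ξ‖ ^ 2)) =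
        ∫ s, Real.cos (inner ℝ x ξ) * (h ξ * Real.exp (-δ * ‖ξ‖ ^ 2)) *
          Real.exp (-s * ‖ξ‖ ^ 2) ∂ν := fun ξ => by
      rw [integral_const_mul]
      ring
    simp only [hfubini]
    rw [integral_integral_swap]
    · refine integral_nonneg_of_ae ?_
      filter_upwards [hν] with s hs
      refine (hh.nonneg (δ + s) (by positivity) x).trans_eq (integral_congr_ae ?_)
      refine Eventually.of_forall fun ξ => ?_
      simp only [neg_add, add_mul, Real.exp_add]
      ring
    · refine ((integrable_cos_inner_mul x (hh.integrable_mul_gaussian hδ)).comp_fst ν).mono ?_ ?_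
      · have := hh.measurable
        exact Measurable.aestronglyMeasurable (by fun_prop)
      · filter_upwards [Measure.quasiMeasurePreserving_snd.ae hν] with q hq
        rw [Function.uncurry, norm_mul, Real.norm_eq_abs (Real.exp _), Real.abs_exp]
        exact mul_le_of_le_one_right (norm_nonneg _)
          (Real.exp_le_one_iff.2 (by nlinarith [mul_nonneg hq (sq_nonneg ‖q.1‖)]))

lemma integral_gaussian_pow {ν : Measure ℝ} [IsProbabilityMeasure ν] (hν : ∀ᵐ s ∂ν, 0 ≤ s)
    (k : ℕ) : CosPositive (fun ξ : V => (∫ s, Real.exp (-s * ‖ξ‖ ^ 2) ∂ν) ^ k) := by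
  induction k with
  | zero => simpa only [pow_zero] using CosPositive.one
  | succ k ih => simpa only [pow_succ] using ih.mul_integral_gaussian hν

lemma comp_smul {h : V → ℝ} (hh : CosPositive h) {c : ℝ} (hc : 0 < c) :
    CosPositive (fun ξ => h (c • ξ)) where
  measurable := hh.measurable.comp (by fun_prop)
  abs_le_one ξ := hh.abs_le_one _
  nonneg δ hδ x := by
    have hscale : ∀ ξ : V, Real.cos (inner ℝ x ξ) * (h (c • ξ) * Real.exp (-δ * ‖ξ‖ ^ 2)) =
        (fun η => Real.cos (inner ℝ (c⁻¹ • x) η) *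
          (h η * Real.exp (-(δ / c ^ 2) * ‖η‖ ^ 2))) (c • ξ) := fun ξ => by
      have hsq : δ / c ^ 2 * ‖c • ξ‖ ^ 2 = δ * ‖ξ‖ ^ 2 := by
        rw [norm_smul, Real.norm_eq_abs, mul_pow, sq_abs]
        field_simp
      simp only [inner_smul_left, inner_smul_right, neg_mul, hsq]
      simp [hc.ne']
    rw [integral_congr_ae (Eventually.of_forall hscale),
      Measure.integral_comp_smul volume (fun η => Real.cos (inner ℝ (c⁻¹ • x) η) *
        (h η * Real.exp (-(δ / c ^ 2) * ‖η‖ ^ 2)))]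
    exact smul_nonneg (abs_nonneg _) (hh.nonneg _ (by positivity) _)

end CosPositive

end CosineTransform

section Pareto

variable {α : ℝ}

lemma ae_nonneg_paretoMeasure : ∀ᵐ s ∂paretoMeasure 1 α, 0 ≤ s := by
  rw [paretoMeasure, ae_withDensity_iff (f := paretoPDF 1 α)
    (measurable_paretoPDFReal 1 α).ennreal_ofReal]
  refine Eventually.of_forall fun s hs => ?_
  by_contra! h
  exact hs (paretoPDF_of_lt (by linarith))

lemma integral_paretoMeasure (hα : 0 < α) (g : ℝ → ℝ) :
    ∫ s, g s ∂paretoMeasure 1 α = α * ∫ s in Ioi (1 : ℝ), g s * s ^ (-1 - α) := by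
  rw [paretoMeasure, integral_withDensity_eq_integral_toReal_smul (f := paretoPDF 1 α)
    (measurable_paretoPDFReal 1 α).ennreal_ofReal (by simp [paretoPDF]),
    ← integral_Ici_eq_integral_Ioi, ← integral_indicator measurableSet_Ici, ← integral_const_mul]
  congr 1 with s
  by_cases hs : 1 ≤ s
  · rw [paretoPDF_of_le hs, ENNReal.toReal_ofReal (by positivity),
      indicator_of_mem (mem_Ici.2 hs), smul_eq_mul, Real.one_rpow,
      show -(α + 1) = -1 - α by ring]
    ring
  · rw [paretoPDF_of_lt (not_le.1 hs), indicator_of_notMem (by simpa using hs)]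
    simp

lemma integrableOn_one_sub_exp_mul_rpow (hα : 0 < α) (hα1 : α < 1) :
    IntegrableOn (fun s : ℝ => (1 - Real.exp (-s)) * s ^ (-1 - α)) (Ioi 0) := by
  have hm : Measurable (fun s : ℝ => (1 - Real.exp (-s)) * s ^ (-1 - α)) := by fun_prop
  have hnorm : ∀ s > (0 : ℝ), ‖(1 - Real.exp (-s)) * s ^ (-1 - α)‖ =
      (1 - Real.exp (-s)) * s ^ (-1 - α) := fun s hs =>
    Real.norm_of_nonneg (mul_nonneg (by simpa using hs.le) (by positivity))
  rw [← Ioc_union_Ioi_eq_Ioi zero_le_one]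
  refine IntegrableOn.union ?_ ?_
  · refine (intervalIntegral.intervalIntegrable_rpow' (a := 0) (b := 1) (r := -α)
      (by linarith)).1.mono' hm.aestronglyMeasurable
      (ae_restrict_of_forall_mem measurableSet_Ioc fun s hs => ?_)
    rw [hnorm s hs.1, show -α = 1 + (-1 - α) by ring, Real.rpow_add hs.1, Real.rpow_one]
    have := hs.1
    gcongr ?_ * _
    linarith [Real.add_one_le_exp (-s)]
  · refine (integrableOn_Ioi_rpow_of_lt (a := -1 - α) (by linarith) one_pos).mono'
      hm.aestronglyMeasurable
      (ae_restrict_of_forall_mem measurableSet_Ioi fun s (hs : 1 < s) => ?_)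
    have hs0 : 0 < s := one_pos.trans hs
    rw [hnorm s hs0]
    exact mul_le_of_le_one_left (by positivity) (by linarith [Real.exp_pos (-s)])

lemma integral_one_sub_exp_mul_rpow_pos (hα : 0 < α) (hα1 : α < 1) :
    0 < ∫ s in Ioi (0 : ℝ), (1 - Real.exp (-s)) * s ^ (-1 - α) := by
  have hpos : ∀ s ∈ Ioi (0 : ℝ), 0 < (1 - Real.exp (-s)) * s ^ (-1 - α) := fun s (hs : 0 < s) =>
    mul_pos (by simpa using hs) (by positivity)
  rw [setIntegral_pos_iff_support_of_nonneg_ae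
    (ae_restrict_of_forall_mem measurableSet_Ioi fun s hs => (hpos s hs).le)
    (integrableOn_one_sub_exp_mul_rpow hα hα1)]
  refine lt_of_lt_of_le (by simp) (measure_mono (s := Ioi (0 : ℝ)) fun s hs => ?_)
  exact ⟨(hpos s hs).ne', hs⟩

lemma one_sub_integral_exp_paretoMeasure (hα : 0 < α) {r : ℝ} (hr : 0 < r) :
    1 - ∫ s, Real.exp (-s * r) ∂paretoMeasure 1 α =
      α * r ^ α * ∫ s in Ioi r, (1 - Real.exp (-s)) * s ^ (-1 - α) := by
  have := isProbabilityMeasure_paretoMeasure one_pos hα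
  have hint : Integrable (fun s => Real.exp (-s * r)) (paretoMeasure 1 α) := by
    refine .of_bound (C := 1) (by fun_prop) ?_
    filter_upwards [ae_nonneg_paretoMeasure] with s hs
    rw [Real.norm_eq_abs, Real.abs_exp, Real.exp_le_one_iff]
    nlinarith
  have hscale : ∀ s ∈ Ioi (1 : ℝ), (1 - Real.exp (-s * r)) * s ^ (-1 - α) =
      r ^ (1 + α) * ((1 - Real.exp (-(s * r))) * (s * r) ^ (-1 - α)) := fun s (hs : 1 < s) => by
    have hcancel : r ^ (1 + α) * r ^ (-1 - α) = 1 := by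
      rw [← Real.rpow_add hr, show 1 + α + (-1 - α) = 0 by ring, Real.rpow_zero]
    rw [Real.mul_rpow (by linarith) hr.le, neg_mul]
    linear_combination (-(1 - Real.exp (-(s * r))) * s ^ (-1 - α)) * hcancel
  calc 1 - ∫ s, Real.exp (-s * r) ∂paretoMeasure 1 α
      = ∫ s, (1 - Real.exp (-s * r)) ∂paretoMeasure 1 α := by
        rw [integral_sub (integrable_const 1) hint, integral_const, probReal_univ, one_smul]
    _ = α * (r ^ (1 + α) * (r⁻¹ * ∫ s in Ioi r, (1 - Real.exp (-s)) * s ^ (-1 - α))) := by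
        rw [integral_paretoMeasure hα, setIntegral_congr_fun measurableSet_Ioi hscale,
          integral_const_mul,
          integral_comp_mul_right_Ioi (fun s => (1 - Real.exp (-s)) * s ^ (-1 - α)) 1 hr,
          one_mul, smul_eq_mul]
    _ = _ := by
        rw [Real.rpow_add hr, Real.rpow_one]
        field_simp

lemma tendsto_integral_Ioi_nhdsGT_zero {g : ℝ → ℝ} (hg : IntegrableOn g (Ioi 0)) :
    Tendsto (fun r => ∫ s in Ioi r, g s) (𝓝[>] 0) (𝓝 (∫ s in Ioi 0, g s)) := by
  refine ((aecover_Ioi_of_Ioi (tendsto_id.mono_left nhdsWithin_le_nhds)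
    ).integral_tendsto_of_countably_generated hg).congr' ?_
  filter_upwards [self_mem_nhdsWithin] with r (hr : 0 < r)
  rw [Measure.restrict_restrict measurableSet_Ioi, id, Ioi_inter_Ioi, max_eq_left hr.le]

lemma exists_tendsto_integral_exp_paretoMeasure_pow (hα : 0 < α) (hα1 : α < 1) :
    ∃ c : ℕ → ℝ, (∀ k, 0 < c k) ∧ ∀ r : ℝ, 0 ≤ r →
      Tendsto (fun k => (∫ s, Real.exp (-s * (c k * r)) ∂paretoMeasure 1 α) ^ k) atTop
        (𝓝 (Real.exp (-r ^ α))) := by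
  have := isProbabilityMeasure_paretoMeasure one_pos hα
  set J : ℝ → ℝ := fun r => ∫ s in Ioi r, (1 - Real.exp (-s)) * s ^ (-1 - α)
  have hJ0 : 0 < J 0 := integral_one_sub_exp_mul_rpow_pos hα hα1
  set b : ℕ → ℝ := fun k => (α * J 0)⁻¹ * ((k : ℝ) + 1)⁻¹ with hb
  have hbpos : ∀ k, 0 < b k := fun k => by positivity
  have hb0 : Tendsto b atTop (𝓝 0) := by
    simpa [hb] using (tendsto_one_div_add_atTop_nhds_zero_nat (𝕜 := ℝ)).const_mul (α * J 0)⁻¹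
  have hkb : Tendsto (fun k => k * b k) atTop (𝓝 (α * J 0)⁻¹) := by
    simpa [hb, div_eq_mul_inv, mul_left_comm] using
      (tendsto_natCast_div_add_atTop (1 : ℝ)).const_mul (α * J 0)⁻¹
  refine ⟨fun k => b k ^ α⁻¹, fun k => Real.rpow_pos_of_pos (hbpos k) _, fun r hr => ?_⟩
  rcases hr.eq_or_lt with rfl | hr
  · simp [Real.zero_rpow hα.ne']
  have hc : Tendsto (fun k => b k ^ α⁻¹ * r) atTop (𝓝[>] 0) := by
    refine tendsto_nhdsWithin_iff.2 ⟨?_, Eventually.of_forall fun k =>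
      mul_pos (Real.rpow_pos_of_pos (hbpos k) _) hr⟩
    simpa [Real.zero_rpow (inv_ne_zero hα.ne')] using
      (hb0.rpow_const (Or.inr (inv_nonneg.2 hα.le))).mul_const r
  have hlim := (hkb.mul_const (r ^ α)).mul
    (((tendsto_integral_Ioi_nhdsGT_zero (integrableOn_one_sub_exp_mul_rpow hα hα1)).comp
      hc).const_mul α)
  rw [show (α * J 0)⁻¹ * r ^ α * (α * J 0) = r ^ α by field_simp] at hlim
  have hpow : Tendsto (fun k : ℕ => (k : ℝ) *
      (∫ s, Real.exp (-s * (b k ^ α⁻¹ * r)) ∂paretoMeasure 1 α - 1)) atTop (𝓝 (-r ^ α)) := by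
    refine hlim.neg.congr fun k => ?_
    have hone := one_sub_integral_exp_paretoMeasure hα
      (mul_pos (Real.rpow_pos_of_pos (hbpos k) α⁻¹) hr)
    rw [Real.mul_rpow (Real.rpow_nonneg (hbpos k).le _) hr.le,
      Real.rpow_inv_rpow (hbpos k).le hα.ne'] at hone
    simp only [Function.comp_apply]
    linear_combination (k : ℝ) * hone
  simpa using Real.tendsto_one_add_pow_exp_of_tendsto hpow

end Pareto

/-! ### The stable law and its semigroup -/

section Normalization

variable {V : Type*} [NormedAddCommGroup V] [InnerProductSpace ℝ V] [FiniteDimensional ℝ V]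
  [MeasurableSpace V] [BorelSpace V]

lemma cosPositive_exp_neg_rpow {β : ℝ} (hβ0 : 0 < β) (hβ2 : β ≤ 2) :
    CosPositive (fun ξ : V => Real.exp (-‖ξ‖ ^ β)) := by
  rcases hβ2.eq_or_lt with rfl | hβ2
  · refine ⟨by fun_prop, fun ξ => ?_, fun δ hδ x => ?_⟩
    · rw [Real.abs_exp, Real.exp_le_one_iff, neg_nonpos]
      positivity
    · refine (CosPositive.one.nonneg (1 + δ) (by positivity) x).trans_eq ?_
      congr 1 with ξ
      rw [one_mul, ← Real.exp_add, Real.rpow_two]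
      ring_nf
  have hα : 0 < β / 2 := by positivity
  have hν := isProbabilityMeasure_paretoMeasure one_pos hα
  obtain ⟨c, hc, hlim⟩ := exists_tendsto_integral_exp_paretoMeasure_pow hα (by linarith)
  refine CosPositive.of_tendsto (fun k => (CosPositive.integral_gaussian_pow
    (ν := paretoMeasure 1 (β / 2)) ae_nonneg_paretoMeasure k).comp_smul
    (Real.sqrt_pos.2 (hc k))) fun ξ => ?_
  convert! hlim (‖ξ‖ ^ 2) (by positivity) using 2 with k
  · rw [norm_smul, mul_pow, Real.norm_eq_abs, sq_abs, Real.sq_sqrt (hc k).le]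
  · rw [← Real.rpow_natCast, ← Real.rpow_mul (norm_nonneg ξ)]
    congr 1
    push_cast
    ring_nf

lemma integral_integral_cos_inner_mul_gaussian {g : V → ℝ} (hg : Integrable g) {c : ℝ}
    (hc : 0 < c) :
    ∫ x : V, (∫ ξ, Real.cos (inner ℝ x ξ) * g ξ) * Real.exp (-(4 * Real.pi ^ 2 * c)⁻¹ * ‖x‖ ^ 2) =
      (2 * Real.pi) ^ finrank ℝ V *
        ∫ ξ, (Real.pi * c) ^ (finrank ℝ V / 2 : ℝ) * Real.exp (-Real.pi ^ 2 * c * ‖ξ‖ ^ 2) *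
          g ξ := by
  have hδ : 0 < (4 * Real.pi ^ 2 * c)⁻¹ := by positivity
  set δ := (4 * Real.pi ^ 2 * c)⁻¹ with hδ_def
  have hgauss : ∀ ξ : V, ∫ x, Real.cos (inner ℝ x ξ) * g ξ * Real.exp (-δ * ‖x‖ ^ 2) =
      (2 * Real.pi) ^ finrank ℝ V * ((Real.pi * c) ^ (finrank ℝ V / 2 : ℝ) *
        Real.exp (-Real.pi ^ 2 * c * ‖ξ‖ ^ 2) * g ξ) := fun ξ => by
    have hpow : (Real.pi / δ) ^ (finrank ℝ V / 2 : ℝ) =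
        (2 * Real.pi) ^ finrank ℝ V * (Real.pi * c) ^ (finrank ℝ V / 2 : ℝ) := by
      rw [show Real.pi / δ = (2 * Real.pi) ^ (2 : ℝ) * (Real.pi * c) by
          rw [hδ_def, Real.rpow_two]; field_simp; norm_num,
        Real.mul_rpow (by positivity) (by positivity), ← Real.rpow_mul (by positivity),
        mul_div_cancel₀ _ two_ne_zero, Real.rpow_natCast]
    have hexp : -‖ξ‖ ^ 2 / (4 * δ) = -Real.pi ^ 2 * c * ‖ξ‖ ^ 2 := by
      rw [hδ_def]
      field_simp
    rw [← hexp, ← mul_assoc, ← mul_assoc, ← hpow, ← integral_cos_inner_mul_gaussian hδ,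
      ← integral_mul_const]
    congr 1 with x
    rw [real_inner_comm]
    ring
  simp only [← integral_mul_const]
  rw [integral_integral_swap]
  · simp only [hgauss, integral_const_mul]
  · refine ((integrable_gaussian (V := V) hδ).mul_prod hg).mono ?_ ?_
    · have hcos : Continuous fun q : V × V => Real.cos (inner ℝ q.1 q.2) := by fun_prop
      exact (hcos.aestronglyMeasurable.mul hg.1.comp_snd).mul
        (Continuous.aestronglyMeasurable (by fun_prop))
    · refine Eventually.of_forall fun q => ?_
      simp only [Function.uncurry, norm_mul]
      rw [mul_comm ‖Real.exp _‖]
      gcongr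
      exact mul_le_of_le_one_left (norm_nonneg _) (Real.abs_cos_le_one _)

lemma tendsto_integral_gaussian_mul {g : V → ℝ} (hg : Integrable g) (hg0 : ContinuousAt g 0) :
    Tendsto (fun c : ℝ => ∫ ξ, (Real.pi * c) ^ (finrank ℝ V / 2 : ℝ) *
      Real.exp (-Real.pi ^ 2 * c * ‖ξ‖ ^ 2) * g ξ) atTop (𝓝 (g 0)) := by
  have h := (Complex.continuous_re.tendsto _).comp (Real.tendsto_integral_gaussian_smul'
    hg.ofReal (Complex.continuous_ofReal.continuousAt.comp hg0))
  refine h.congr' ?_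
  filter_upwards [eventually_ge_atTop 0] with c hc
  have hreal : ∀ ξ : V, (((Real.pi : ℂ) * c) ^ ((finrank ℝ V : ℂ) / 2) *
      Complex.exp (-(Real.pi : ℂ) ^ 2 * c * (‖0 - ξ‖ : ℂ) ^ 2)) • (g ξ : ℂ) =
      (((Real.pi * c) ^ (finrank ℝ V / 2 : ℝ) * Real.exp (-Real.pi ^ 2 * c * ‖ξ‖ ^ 2) * g ξ : ℝ) :
        ℂ) := fun ξ => by
    rw [Complex.ofReal_mul, Complex.ofReal_mul, Complex.ofReal_cpow (by positivity)]
    push_cast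
    simp
  simp only [Function.comp_apply]
  rw [integral_congr_ae (Eventually.of_forall hreal), integral_complex_ofReal, Complex.ofReal_re]

lemma lintegral_integral_cos_inner_mul {g : V → ℝ} (hg : Integrable g) (hg0 : ContinuousAt g 0)
    (hpos : ∀ x : V, 0 ≤ ∫ ξ, Real.cos (inner ℝ x ξ) * g ξ) :
    ∫⁻ x : V, ENNReal.ofReal (∫ ξ, Real.cos (inner ℝ x ξ) * g ξ) =
      ENNReal.ofReal ((2 * Real.pi) ^ finrank ℝ V * g 0) := by
  set G : V → ℝ := fun x => ∫ ξ, Real.cos (inner ℝ x ξ) * g ξ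
  have hGm : AEStronglyMeasurable G := by
    have hcos : Continuous fun q : V × V => Real.cos (inner ℝ q.1 q.2) := by fun_prop
    exact (hcos.aestronglyMeasurable.mul hg.1.comp_snd).integral_prod_right'
  have hGle : ∀ x, ‖G x‖ ≤ ∫ ξ, |g ξ| := fun x =>
    norm_integral_le_of_norm_le hg.abs (Eventually.of_forall fun ξ => abs_cos_mul_le _ _)
  have hbound : ∀ c : ℝ, 0 < c → Integrable fun x => G x *
      Real.exp (-(4 * Real.pi ^ 2 * c)⁻¹ * ‖x‖ ^ 2) := fun c hc =>
    (integrable_gaussian (by positivity)).bdd_mul hGm (Eventually.of_forall hGle)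
  have hδ : Tendsto (fun k : ℕ => -(4 * Real.pi ^ 2 * ((k : ℝ) + 1))⁻¹) atTop (𝓝 0) := by
    have h := ((tendsto_one_div_add_atTop_nhds_zero_nat (𝕜 := ℝ)).const_mul
      (4 * Real.pi ^ 2)⁻¹).neg
    rw [mul_zero, neg_zero] at h
    exact h.congr fun k => by rw [mul_inv (4 * Real.pi ^ 2), one_div]
  have hmono : Tendsto (fun k : ℕ => ∫⁻ x, ENNReal.ofReal (G x *
      Real.exp (-(4 * Real.pi ^ 2 * ((k : ℝ) + 1))⁻¹ * ‖x‖ ^ 2))) atTop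
      (𝓝 (∫⁻ x, ENNReal.ofReal (G x))) := by
    refine lintegral_tendsto_of_tendsto_of_monotone
      (fun k => (hbound _ (by positivity)).aestronglyMeasurable.aemeasurable.ennreal_ofReal)
      (Eventually.of_forall fun x i j hij => ENNReal.ofReal_le_ofReal ?_)
      (Eventually.of_forall fun x => ENNReal.tendsto_ofReal ?_)
    · have := hpos x
      gcongr
    · simpa using ((hδ.mul_const (‖x‖ ^ 2)).rexp).const_mul (G x)
  have happrox := ENNReal.tendsto_ofReal
    (((tendsto_integral_gaussian_mul hg hg0).comp (tendsto_atTop_add_const_right _ (1 : ℝ)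
      tendsto_natCast_atTop_atTop)).const_mul ((2 * Real.pi) ^ finrank ℝ V))
  refine tendsto_nhds_unique hmono (happrox.congr fun k => ?_)
  rw [Function.comp_apply, ← integral_integral_cos_inner_mul_gaussian hg (by positivity),
    ofReal_integral_eq_lintegral_ofReal (hbound _ (by positivity))
      (Eventually.of_forall fun x => mul_nonneg (hpos x) (Real.exp_pos _).le)]

lemma integrable_exp_neg_rpow {β : ℝ} (hβ : 0 < β) :
    Integrable (fun ξ : V => Real.exp (-‖ξ‖ ^ β)) := by
  cases subsingleton_or_nontrivial V
  · exact Integrable.of_finite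
  rw [integrable_fun_norm_addHaar (volume : Measure V) (f := fun r => Real.exp (-r ^ β))]
  refine (integrableOn_rpow_mul_exp_neg_rpow (s := ((finrank ℝ V - 1 : ℕ) : ℝ)) ?_ hβ).congr_fun
    (fun r _ => by simp [Real.rpow_natCast]) measurableSet_Ioi
  linarith [Nat.cast_nonneg (α := ℝ) (finrank ℝ V - 1)]

end Normalization

section Kernel

variable {n : ℕ} {β : ℝ}

lemma kernel_one_eq (hβ : 0 < β) (x : E n) :
    kernel β 1 x = ((2 * Real.pi) ^ n)⁻¹ *
      ∫ ξ : E n, Real.cos (inner ℝ x ξ) * Real.exp (-‖ξ‖ ^ β) := by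
  have hexp : ∀ ξ : E n, Complex.exp (Complex.I * ((inner ℝ x ξ : ℝ) : ℂ) -
      ((1 * ‖ξ‖ ^ β : ℝ) : ℂ)) =
      Complex.exp (((inner ℝ x ξ : ℝ) : ℂ) * Complex.I) * ((Real.exp (-‖ξ‖ ^ β) : ℝ) : ℂ) := by
    intro ξ
    rw [Complex.ofReal_exp, ← Complex.exp_add]
    congr 1
    push_cast
    ring
  have hint : Integrable fun ξ : E n => Complex.exp (((inner ℝ x ξ : ℝ) : ℂ) * Complex.I) *
      ((Real.exp (-‖ξ‖ ^ β) : ℝ) : ℂ) :=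
    (integrable_exp_neg_rpow hβ).ofReal.bdd_mul (c := 1)
      (Continuous.aestronglyMeasurable (by fun_prop))
      (Eventually.of_forall fun ξ => (Complex.norm_exp_ofReal_mul_I _).le)
  have hre := Complex.reCLM.integral_comp_comm hint
  simp only [Complex.reCLM_apply, Complex.re_mul_ofReal, Complex.exp_ofReal_mul_I_re] at hre
  rw [kernel, funext hexp, ← hre]

lemma kernel_one_nonneg (hβ0 : 0 < β) (hβ2 : β ≤ 2) (x : E n) : 0 ≤ kernel β 1 x := by
  rw [kernel_one_eq hβ0]
  exact mul_nonneg (by positivity) ((cosPositive_exp_neg_rpow hβ0 hβ2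
    ).integral_cos_inner_mul_nonneg (integrable_exp_neg_rpow hβ0) x)

lemma kernel_one_le (hβ : 0 < β) (x : E n) :
    kernel β 1 x ≤ ((2 * Real.pi) ^ n)⁻¹ * ∫ ξ : E n, Real.exp (-‖ξ‖ ^ β) := by
  have hint := integrable_exp_neg_rpow (V := E n) hβ
  rw [kernel_one_eq hβ]
  gcongr
  · exact integrable_cos_inner_mul x hint
  · exact fun ξ => mul_le_of_le_one_left (Real.exp_pos _).le (Real.cos_le_one _)

lemma measurable_kernel_one (hβ : 0 < β) : Measurable (kernel β 1 : E n → ℝ) := by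
  have hm : StronglyMeasurable fun q : E n × E n =>
      Real.cos (inner ℝ q.1 q.2) * Real.exp (-‖q.2‖ ^ β) :=
    Measurable.stronglyMeasurable (by fun_prop)
  rw [funext (kernel_one_eq hβ)]
  exact hm.integral_prod_right.measurable.const_mul _

lemma lintegral_kernel_one (hβ0 : 0 < β) (hβ2 : β ≤ 2) :
    ∫⁻ x : E n, ENNReal.ofReal (kernel β 1 x) = 1 := by
  have hint := integrable_exp_neg_rpow (V := E n) hβ0
  have hcont : Continuous fun ξ : E n => Real.exp (-‖ξ‖ ^ β) :=
    (continuous_norm.rpow_const fun _ => Or.inr hβ0.le).neg.rexp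
  have hmass := lintegral_integral_cos_inner_mul hint hcont.continuousAt
    ((cosPositive_exp_neg_rpow hβ0 hβ2).integral_cos_inner_mul_nonneg hint)
  have hmul : ∀ x : E n, ENNReal.ofReal (kernel β 1 x) = ENNReal.ofReal ((2 * Real.pi) ^ n)⁻¹ *
      ENNReal.ofReal (∫ ξ : E n, Real.cos (inner ℝ x ξ) * Real.exp (-‖ξ‖ ^ β)) := fun x => by
    rw [kernel_one_eq hβ0, ENNReal.ofReal_mul (by positivity)]
  rw [funext hmul, lintegral_const_mul' _ _ ENNReal.ofReal_ne_top, hmass,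
    ← ENNReal.ofReal_mul (by positivity), finrank_euclideanSpace_fin, norm_zero,
    Real.zero_rpow hβ0.ne', neg_zero, Real.exp_zero, mul_one, inv_mul_cancel₀ (by positivity),
    ENNReal.ofReal_one]

lemma kernel_scaling {t : ℝ} (hβ : 0 < β) (ht : 0 < t) (x : E n) :
    kernel β t x = ((t ^ (1 / β)) ^ n)⁻¹ * kernel β 1 ((t ^ (1 / β))⁻¹ • x) := by
  have hr : 0 < t ^ (1 / β) := by positivity
  have hrβ : (t ^ (1 / β)) ^ β = t := by
    rw [← Real.rpow_mul ht.le, one_div_mul_cancel hβ.ne', Real.rpow_one]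
  set r := t ^ (1 / β)
  set F : E n → ℂ := fun ζ => Complex.exp (Complex.I * ((inner ℝ (r⁻¹ • x) ζ : ℝ) : ℂ) -
    ((1 * ‖ζ‖ ^ β : ℝ) : ℂ)) with hF
  have hscale : ∀ ξ : E n, Complex.exp (Complex.I * ((inner ℝ x ξ : ℝ) : ℂ) -
      ((t * ‖ξ‖ ^ β : ℝ) : ℂ)) = F (r • ξ) := fun ξ => by
    simp only [hF]
    rw [real_inner_smul_left, real_inner_smul_right, inv_mul_cancel_left₀ hr.ne', norm_smul,
      Real.norm_eq_abs, abs_of_pos hr, Real.mul_rpow hr.le (norm_nonneg _), hrβ, one_mul]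
  rw [kernel, funext hscale, Measure.integral_comp_smul_of_nonneg volume F r (hR := hr.le),
    finrank_euclideanSpace_fin, Complex.smul_re, smul_eq_mul, kernel]
  ring

variable (n β) in
/-- The law of the standard isotropic `β`-stable random vector in `ℝⁿ`: the measure with density
`S_β(·, 1)`. -/
def stableLaw : Measure (E n) := volume.withDensity fun z => ENNReal.ofReal (kernel β 1 z)

lemma isProbabilityMeasure_stableLaw (hβ0 : 0 < β) (hβ2 : β ≤ 2) :
    IsProbabilityMeasure (stableLaw n β) :=
  ⟨by rw [stableLaw, withDensity_apply _ MeasurableSet.univ, setLIntegral_univ,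
    lintegral_kernel_one hβ0 hβ2]⟩

lemma exists_stableLaw_le (hβ : 0 < β) :
    ∃ c : ℝ≥0, stableLaw n β ≤ (c : ℝ≥0∞) • (volume : Measure (E n)) :=
  ⟨_, (withDensity_mono (Eventually.of_forall fun z =>
    ENNReal.ofReal_le_ofReal (kernel_one_le hβ z))).trans_eq (withDensity_const _)⟩

end Kernel

/-- The average of `g` over the translates `x - r z`, with `z` distributed according to `P`. For
the stable law and `r = t ^ (1 / β)` this is the semigroup `e^{-t(-Δ)^{β/2}}`. -/
def avg {V : Type*} [NormedAddCommGroup V] [InnerProductSpace ℝ V] [MeasurableSpace V]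
    (P : Measure V) (r : ℝ) (g : V → ℝ) (x : V) : ℝ :=
  ∫ z, g (x - r • z) ∂P

lemma semigroup_eq_avg {n : ℕ} {β t : ℝ} (hβ0 : 0 < β) (hβ2 : β ≤ 2) (ht : 0 ≤ t)
    (g : E n → ℝ) (x : E n) : semigroup β t g x = avg (stableLaw n β) (t ^ (1 / β)) g x := by
  have := isProbabilityMeasure_stableLaw (n := n) hβ0 hβ2
  rcases ht.eq_or_lt with rfl | ht
  · simp [semigroup, avg, Real.zero_rpow (inv_pos.2 hβ0).ne']
  have hr : 0 < t ^ (1 / β) := by positivity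
  rw [semigroup, if_neg ht.ne', avg, stableLaw, integral_withDensity_eq_integral_toReal_smul
      (measurable_kernel_one hβ0).ennreal_ofReal (by simp),
    ← integral_sub_left_eq_self _ volume x]
  simp only [sub_sub_cancel, kernel_scaling hβ0 ht, smul_eq_mul, mul_assoc, integral_const_mul,
    ENNReal.toReal_ofReal (kernel_one_nonneg hβ0 hβ2 _)]
  set r := t ^ (1 / β)
  have h := Measure.integral_comp_inv_smul_of_nonneg (volume : Measure (E n))
    (fun z => kernel β 1 z * g (x - r • z)) hr.le
  simp only [smul_inv_smul₀ hr.ne', finrank_euclideanSpace_fin, smul_eq_mul] at h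
  rw [h, inv_mul_cancel_left₀ (by positivity)]

/-! ### Exponential integrals -/

/-- The Young function `exp (μ |y|^p) - 1` of `exp L^p`, with a rate `μ` in place of the scale
`l = μ^{-1/p}`. -/
def youngFun (p μ y : ℝ) : ℝ := Real.exp (μ * |y| ^ p) - 1

section youngFun

variable {p μ : ℝ}

lemma youngFun_zero (hp : p ≠ 0) : youngFun p μ 0 = 0 := by
  simp [youngFun, Real.zero_rpow hp]

lemma youngFun_neg (y : ℝ) : youngFun p μ (-y) = youngFun p μ y := by
  rw [youngFun, youngFun, abs_neg]

lemma youngFun_nonneg (hμ : 0 ≤ μ) (y : ℝ) : 0 ≤ youngFun p μ y :=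
  sub_nonneg.2 (Real.one_le_exp (by positivity))

lemma mul_rpow_le_youngFun (y : ℝ) : μ * |y| ^ p ≤ youngFun p μ y :=
  le_sub_iff_add_le.2 (Real.add_one_le_exp _)

lemma youngFun_le_of_abs_le {y z : ℝ} (hp : 0 ≤ p) (hμ : 0 ≤ μ) (h : |y| ≤ |z|) :
    youngFun p μ y ≤ youngFun p μ z := by
  unfold youngFun
  gcongr

lemma continuous_youngFun (hp : 0 ≤ p) : Continuous (youngFun p μ) := by
  have : Continuous fun y : ℝ => |y| ^ p := continuous_abs.rpow_const fun _ => Or.inr hp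
  unfold youngFun
  fun_prop

@[fun_prop]
lemma measurable_youngFun : Measurable (youngFun p μ) := by
  unfold youngFun
  fun_prop

lemma abs_add_rpow_le_max (hp : 0 ≤ p) (a b : ℝ) :
    |a + b| ^ p ≤ max (2 ^ p * |a| ^ p) (2 ^ p * |b| ^ p) := by
  rw [← Real.mul_rpow zero_le_two (abs_nonneg a), ← Real.mul_rpow zero_le_two (abs_nonneg b)]
  rcases le_total |a| |b| with h | h
  · refine le_max_of_le_right (Real.rpow_le_rpow (abs_nonneg _) ?_ hp)
    linarith [abs_add_le a b]
  · refine le_max_of_le_left (Real.rpow_le_rpow (abs_nonneg _) ?_ hp)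
    linarith [abs_add_le a b]

lemma youngFun_add_le (hp : 0 ≤ p) (hμ : 0 ≤ μ) (a b : ℝ) :
    youngFun p μ (a + b) ≤ youngFun p (μ * 2 ^ p) a + youngFun p (μ * 2 ^ p) b := by
  have ha := youngFun_nonneg (p := p) (show 0 ≤ μ * 2 ^ p by positivity) a
  have hb := youngFun_nonneg (p := p) (show 0 ≤ μ * 2 ^ p by positivity) b
  have h := mul_le_mul_of_nonneg_left (abs_add_rpow_le_max hp a b) hμ
  unfold youngFun at *
  rcases max_choice (2 ^ p * |a| ^ p) (2 ^ p * |b| ^ p) with e | e <;> rw [e, ← mul_assoc] at h <;>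
    have := Real.exp_le_exp.2 h <;> linarith

lemma exp_add_sub_one_le {X Y : ℝ} :
    Real.exp (X + Y) - 1 ≤ Real.exp Y * ((Real.exp X - 1) + Y) := by
  have h : Real.exp Y - 1 ≤ Real.exp Y * Y := by
    have h1 := Real.add_one_le_exp (-Y)
    have h2 : Real.exp Y * Real.exp (-Y) = 1 := by
      rw [← Real.exp_add, add_neg_cancel, Real.exp_zero]
    nlinarith [Real.exp_pos Y]
  rw [Real.exp_add]
  linarith

lemma youngFun_add_le_of_abs_le {M b : ℝ} (hp : 0 ≤ p) (hμ : 0 ≤ μ) (a : ℝ) (hb : |b| ≤ M) :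
    youngFun p μ (a + b) ≤ Real.exp (μ * 2 ^ p * M ^ p) *
      (youngFun p (μ * 2 ^ p) a + μ * 2 ^ p * |b| ^ p) := by
  have hadd : μ * |a + b| ^ p ≤ μ * 2 ^ p * |a| ^ p + μ * 2 ^ p * |b| ^ p := by
    refine (mul_le_mul_of_nonneg_left ((abs_add_rpow_le_max hp a b).trans
      (max_le_add_of_nonneg (by positivity) (by positivity))) hμ).trans_eq ?_
    ring
  have ha := youngFun_nonneg (p := p) (show 0 ≤ μ * 2 ^ p by positivity) a
  calc youngFun p μ (a + b)
      ≤ Real.exp (μ * 2 ^ p * |a| ^ p + μ * 2 ^ p * |b| ^ p) - 1 := by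
        unfold youngFun
        gcongr
    _ ≤ Real.exp (μ * 2 ^ p * |b| ^ p) * (youngFun p (μ * 2 ^ p) a + μ * 2 ^ p * |b| ^ p) :=
        exp_add_sub_one_le
    _ ≤ _ := by gcongr

lemma convexOn_youngFun (hp : 1 ≤ p) (hμ : 0 ≤ μ) : ConvexOn ℝ univ (youngFun p μ) := by
  have hrpow : ConvexOn ℝ univ fun y : ℝ => |y| ^ p :=
    ⟨convex_univ, fun x hx y hy a b ha hb hab =>
      (Real.rpow_le_rpow (abs_nonneg _) (convexOn_univ_norm.2 hx hy ha hb hab)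
        (by positivity)).trans
        ((convexOn_rpow hp).2 (abs_nonneg x) (abs_nonneg y) ha hb hab)⟩
  have hexp : ConvexOn ℝ univ fun y : ℝ => Real.exp (μ * |y| ^ p) :=
    ⟨convex_univ, fun x hx y hy a b ha hb hab =>
      (Real.exp_le_exp.2 ((hrpow.smul hμ).2 hx hy ha hb hab)).trans
        (convexOn_exp.2 (mem_univ _) (mem_univ _) ha hb hab)⟩
  exact hexp.sub (concaveOn_const _ convex_univ)

end youngFun

/-- The exponential integral `∫ (exp (μ |u|^p) - 1)`: the modular of `exp L^p` at the scale
`l = μ^{-1/p}`. -/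
def expInt {α : Type*} [MeasurableSpace α] (p μ : ℝ) (u : α → ℝ)
    (ν : Measure α := by volume_tac) : ℝ≥0∞ :=
  ∫⁻ x, ENNReal.ofReal (youngFun p μ (u x)) ∂ν

/-- The integral `∫ |w|^p`: the `p`-th power of the `L^p` seminorm, meaningful even where that
seminorm is infinite. -/
def lpInt {α : Type*} [MeasurableSpace α] (p : ℝ) (w : α → ℝ)
    (ν : Measure α := by volume_tac) : ℝ≥0∞ := ∫⁻ x, ‖w x‖ₑ ^ p ∂ν

lemma enorm_rpow_eq_ofReal {p : ℝ} (hp : 0 ≤ p) (y : ℝ) : ‖y‖ₑ ^ p = ENNReal.ofReal (|y| ^ p) := by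
  rw [Real.enorm_eq_ofReal_abs, ENNReal.ofReal_rpow_of_nonneg (abs_nonneg _) hp]

lemma modular_eq_expInt {n : ℕ} (p l : ℝ) (u : E n → ℝ) :
    modular p u l = expInt p (l ^ p)⁻¹ u := by
  simp only [modular, expInt, youngFun, div_eq_inv_mul]

section expInt

variable {α : Type*} [MeasurableSpace α] {ν : Measure α} {p μ : ℝ} {u v : α → ℝ}

lemma expInt_mono {μ' : ℝ} (h : μ ≤ μ') (u : α → ℝ) : expInt p μ u ν ≤ expInt p μ' u ν := by
  refine lintegral_mono fun x => ENNReal.ofReal_le_ofReal ?_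
  unfold youngFun
  gcongr

lemma expInt_congr (h : u =ᵐ[ν] v) : expInt p μ u ν = expInt p μ v ν :=
  lintegral_congr_ae (h.mono fun x hx => by simp only [hx])

lemma expInt_neg (u : α → ℝ) : expInt p μ (fun x => -u x) ν = expInt p μ u ν := by
  simp only [expInt, youngFun_neg]

lemma expInt_sub_comm (u v : α → ℝ) :
    expInt p μ (fun x => u x - v x) ν = expInt p μ (fun x => v x - u x) ν := by
  rw [← expInt_neg]
  simp only [neg_sub]

lemma expInt_zero (hp : p ≠ 0) : expInt p μ (fun _ => 0) ν = 0 := by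
  simp [expInt, youngFun_zero hp]

lemma expInt_add_le (hp : 0 ≤ p) (hμ : 0 ≤ μ) (hu : Measurable u) (v : α → ℝ) :
    expInt p μ (fun x => u x + v x) ν ≤ expInt p (μ * 2 ^ p) u ν + expInt p (μ * 2 ^ p) v ν := by
  rw [expInt, expInt, expInt, ← lintegral_add_left (by fun_prop)]
  refine lintegral_mono fun x => ?_
  rw [← ENNReal.ofReal_add (youngFun_nonneg (by positivity) _) (youngFun_nonneg (by positivity) _)]
  exact ENNReal.ofReal_le_ofReal (youngFun_add_le hp hμ _ _)

lemma expInt_sub_le (hp : 0 ≤ p) (hμ : 0 ≤ μ) (hu : Measurable u) (v : α → ℝ) :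
    expInt p μ (fun x => u x - v x) ν ≤ expInt p (μ * 2 ^ p) u ν + expInt p (μ * 2 ^ p) v ν := by
  simpa only [sub_eq_add_neg, expInt_neg] using expInt_add_le hp hμ hu (fun x => -v x)

lemma expInt_add_le_of_abs_le {M : ℝ} (hp : 0 ≤ p) (hμ : 0 ≤ μ) (hu : Measurable u)
    (hv : ∀ x, |v x| ≤ M) :
    expInt p μ (fun x => u x + v x) ν ≤ ENNReal.ofReal (Real.exp (μ * 2 ^ p * M ^ p)) *
      (expInt p (μ * 2 ^ p) u ν + ENNReal.ofReal (μ * 2 ^ p) * lpInt p v ν) := by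
  rw [expInt, expInt, lpInt, ← lintegral_const_mul' _ _ ENNReal.ofReal_ne_top,
    ← lintegral_add_left (by fun_prop), ← lintegral_const_mul' _ _ ENNReal.ofReal_ne_top]
  refine lintegral_mono fun x => ?_
  rw [enorm_rpow_eq_ofReal hp, ← ENNReal.ofReal_mul (by positivity),
    ← ENNReal.ofReal_add (youngFun_nonneg (by positivity) _) (by positivity),
    ← ENNReal.ofReal_mul (by positivity)]
  exact ENNReal.ofReal_le_ofReal (youngFun_add_le_of_abs_le hp hμ _ (hv x))

lemma mul_lpInt_le_expInt (hp : 0 ≤ p) (hμ : 0 ≤ μ) (u : α → ℝ) :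
    ENNReal.ofReal μ * lpInt p u ν ≤ expInt p μ u ν := by
  rw [lpInt, expInt, ← lintegral_const_mul' _ _ ENNReal.ofReal_ne_top]
  refine lintegral_mono fun x => ?_
  rw [enorm_rpow_eq_ofReal hp, ← ENNReal.ofReal_mul hμ]
  exact ENNReal.ofReal_le_ofReal (mul_rpow_le_youngFun _)

lemma lpInt_ne_top_of_expInt (hp : 0 ≤ p) (hμ : 0 < μ) (h : expInt p μ u ν ≠ ⊤) :
    lpInt p u ν ≠ ⊤ := by
  intro htop
  have := mul_lpInt_le_expInt (ν := ν) hp hμ.le u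
  rw [htop, ENNReal.mul_top (by simpa using hμ), top_le_iff] at this
  exact h this

lemma ofReal_youngFun_integral_le [IsProbabilityMeasure ν] (hp : 1 ≤ p) (hμ : 0 ≤ μ)
    (hv : AEStronglyMeasurable v ν) :
    ENNReal.ofReal (youngFun p μ (∫ z, v z ∂ν)) ≤ expInt p μ v ν := by
  by_cases hi : Integrable v ν
  swap
  · rw [integral_undef hi, youngFun_zero (by positivity)]
    simp
  by_cases htop : expInt p μ v ν = ⊤
  · exact htop ▸ le_top
  have hnn : 0 ≤ᵐ[ν] fun z => youngFun p μ (v z) :=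
    Eventually.of_forall fun z => youngFun_nonneg hμ _
  have hc : Continuous (youngFun p μ) := continuous_youngFun (by positivity)
  have hj : Integrable (fun z => youngFun p μ (v z)) ν :=
    (lintegral_ofReal_ne_top_iff_integrable (hc.comp_aestronglyMeasurable hv) hnn).1 htop
  rw [expInt, ← ofReal_integral_eq_lintegral_ofReal hj hnn]
  exact ENNReal.ofReal_le_ofReal ((convexOn_youngFun hp hμ).map_integral_le hc.continuousOn
    isClosed_univ (Eventually.of_forall fun _ => mem_univ _) hi hj)

end expInt

lemma rpow_lintegral_le {α : Type*} [MeasurableSpace α] {ν : Measure α} (hν : ν univ ≤ 1) {p : ℝ}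
    (hp : 1 ≤ p) {g : α → ℝ≥0∞} (hg : AEMeasurable g ν) :
    (∫⁻ a, g a ∂ν) ^ p ≤ ∫⁻ a, g a ^ p ∂ν := by
  have hp0 : 0 < p := by linarith
  have h := eLpNorm'_le_eLpNorm'_mul_rpow_measure_univ one_pos hp hg.aestronglyMeasurable
  have hmass : ν univ ^ (1 / 1 - 1 / p) ≤ 1 :=
    ENNReal.rpow_le_one hν (by rw [one_div_one, sub_nonneg]; exact (div_le_one hp0).2 hp)
  have hle := ENNReal.rpow_le_rpow (h.trans (mul_le_of_le_one_right' hmass)) hp0.le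
  rw [← lintegral_rpow_enorm_eq_rpow_eLpNorm' hp0] at hle
  simpa [eLpNorm'] using hle

section Average

variable {V : Type*} [NormedAddCommGroup V] [InnerProductSpace ℝ V] [FiniteDimensional ℝ V]
  [MeasurableSpace V] [BorelSpace V] {P : Measure V} {p q r μ : ℝ} {c : ℝ≥0}

lemma lintegral_lintegral_sub_smul [IsProbabilityMeasure P] {G : V → ℝ≥0∞} (hG : Measurable G)
    (r : ℝ) : ∫⁻ x, ∫⁻ z, G (x - r • z) ∂P = ∫⁻ x, G x := by
  rw [lintegral_lintegral_swap (Measurable.aemeasurable (by fun_prop))]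
  simp only [lintegral_sub_right_eq_self G, lintegral_const, measure_univ, mul_one]

lemma lintegral_sub_smul_le (hP : P ≤ (c : ℝ≥0∞) • volume) {G : V → ℝ≥0∞} (hG : Measurable G)
    (hr : r ≠ 0) (x : V) :
    ∫⁻ z, G (x - r • z) ∂P ≤ c * (ENNReal.ofReal |(r ^ finrank ℝ V)⁻¹| * ∫⁻ y, G y) := by
  refine (lintegral_mono' hP le_rfl).trans_eq ?_
  have hmap : ∫⁻ z : V, G (x - r • z) = ∫⁻ y, G (x - y) ∂(Measure.map (r • ·) volume) :=
    (lintegral_map (f := fun y => G (x - y)) (by fun_prop) (measurable_const_smul r)).symm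
  rw [lintegral_smul_measure, smul_eq_mul, hmap, Measure.map_addHaar_smul _ hr,
    lintegral_smul_measure, smul_eq_mul, lintegral_sub_left_eq_self]

lemma ae_sub_smul (hP : P ≤ (c : ℝ≥0∞) • volume) {Q : V → Prop} (hQ : ∀ᵐ y, Q y) (hr : r ≠ 0)
    (x : V) : ∀ᵐ z ∂P, Q (x - r • z) := by
  have hac : P ≪ (volume : Measure V) :=
    (Measure.absolutelyContinuous_of_le hP).trans Measure.smul_absolutelyContinuous
  exact hac.ae_le ((Measure.quasiMeasurePreserving_smul volume hr).ae
    ((quasiMeasurePreserving_sub_left_of_right_invariant volume x).ae hQ))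

lemma measurable_avg [SFinite P] {α : Type*} [MeasurableSpace α] {g : α → V → ℝ} {r : α → ℝ}
    {x : α → V} (hg : Measurable (Function.uncurry g)) (hr : Measurable r) (hx : Measurable x) :
    Measurable fun a => avg P (r a) (g a) (x a) := by
  have : Measurable fun y : α × V => Function.uncurry g (y.1, x y.1 - r y.1 • y.2) :=
    hg.comp (by fun_prop)
  exact (this.stronglyMeasurable.integral_prod_right' (ν := P)).measurable

lemma expInt_avg_le [IsProbabilityMeasure P] (hp : 1 ≤ p) (hμ : 0 ≤ μ) {u : V → ℝ}
    (hu : Measurable u) (r : ℝ) : expInt p μ (avg P r u) ≤ expInt p μ u := by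
  have hG : Measurable fun x => ENNReal.ofReal (youngFun p μ (u x)) := by fun_prop
  rw [expInt, expInt, ← lintegral_lintegral_sub_smul (P := P) hG r]
  exact lintegral_mono fun x =>
    ofReal_youngFun_integral_le hp hμ (Measurable.aestronglyMeasurable (by fun_prop))

lemma le_add_rpow_mul {A m : ℝ} (hq : 1 ≤ q) (hA : 1 ≤ A) (hm : 1 ≤ m) :
    m ≤ A + A ^ (1 - q) * (m ^ q - 1) := by
  have hA0 : 0 < A := by linarith
  have hm0 : 0 < m := by linarith
  rcases le_total m A with h | h
  · have hmq : 1 ≤ m ^ q := Real.one_le_rpow hm (by linarith)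
    have : 0 ≤ A ^ (1 - q) * (m ^ q - 1) := mul_nonneg (by positivity) (by linarith)
    linarith
  · have hmA : m ≤ A ^ (1 - q) * m ^ q := by
      calc m = A ^ (1 - q) * (A ^ (q - 1) * m) := by
            rw [← mul_assoc, ← Real.rpow_add hA0]
            simp
        _ ≤ A ^ (1 - q) * (m ^ (q - 1) * m) := by
            have : 0 ≤ q - 1 := by linarith
            gcongr
        _ = A ^ (1 - q) * m ^ q := by rw [← Real.rpow_add_one hm0.ne', sub_add_cancel]
    have hA1 : A ^ (1 - q) ≤ A := by
      simpa using Real.rpow_le_rpow_of_exponent_le hA (show 1 - q ≤ 1 by linarith)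
    linarith

lemma exp_mul_rpow_le {A κ : ℝ} (hq : 1 ≤ q) (hA : 1 ≤ A) (hκ : 0 ≤ κ) (y : ℝ) :
    Real.exp (κ * |y| ^ p) ≤ A + A ^ (1 - q) * youngFun p (κ * q) y := by
  have h := le_add_rpow_mul hq hA (Real.one_le_exp (show 0 ≤ κ * |y| ^ p by positivity))
  rwa [← Real.exp_mul, mul_right_comm] at h

-- Split the exponential at the height `r ^ (-d / q)`, which balances the two contributions.
lemma lintegral_exp_sub_smul_le [IsProbabilityMeasure P] (hP : P ≤ (c : ℝ≥0∞) • volume) {κ : ℝ}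
    (hκ : 0 ≤ κ) (hq : 1 ≤ q) (hr : 0 < r) (hr1 : r ≤ 1) {u : V → ℝ} (hu : Measurable u) (x : V) :
    ∫⁻ z, ENNReal.ofReal (Real.exp (κ * |u (x - r • z)| ^ p)) ∂P ≤
      (1 + c * expInt p (κ * q) u) * ENNReal.ofReal (r ^ (-(finrank ℝ V / q))) := by
  have : 0 < q := by linarith
  set A := r ^ (-(finrank ℝ V / q)) with hA
  have hA1 : 1 ≤ A :=
    Real.one_le_rpow_of_pos_of_le_one_of_nonpos hr hr1 (neg_nonpos.2 (by positivity))
  have hA0 : 0 ≤ A := by linarith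
  have hbalance : A ^ (1 - q) * (r ^ finrank ℝ V)⁻¹ = A := by
    rw [hA, ← Real.rpow_natCast, ← Real.rpow_mul hr.le, ← Real.rpow_neg hr.le, ← Real.rpow_add hr]
    congr 1
    field_simp
    ring
  have hpt : ∀ y : V, ENNReal.ofReal (Real.exp (κ * |u y| ^ p)) ≤ ENNReal.ofReal A +
      ENNReal.ofReal (A ^ (1 - q)) * ENNReal.ofReal (youngFun p (κ * q) (u y)) := fun y => by
    rw [← ENNReal.ofReal_mul (by positivity), ← ENNReal.ofReal_add hA0
      (mul_nonneg (by positivity) (youngFun_nonneg (by positivity) _))]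
    exact ENNReal.ofReal_le_ofReal (exp_mul_rpow_le hq hA1 hκ _)
  calc _ ≤ ∫⁻ z, (ENNReal.ofReal A + ENNReal.ofReal (A ^ (1 - q)) *
        ENNReal.ofReal (youngFun p (κ * q) (u (x - r • z)))) ∂P := lintegral_mono fun z => hpt _
    _ = ENNReal.ofReal A + ENNReal.ofReal (A ^ (1 - q)) *
        ∫⁻ z, ENNReal.ofReal (youngFun p (κ * q) (u (x - r • z))) ∂P := by
        rw [lintegral_add_left measurable_const, lintegral_const, measure_univ, mul_one,
          lintegral_const_mul' _ _ ENNReal.ofReal_ne_top]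
    _ ≤ ENNReal.ofReal A + ENNReal.ofReal (A ^ (1 - q)) *
        (c * (ENNReal.ofReal (r ^ finrank ℝ V)⁻¹ * expInt p (κ * q) u)) := by
        have h := lintegral_sub_smul_le hP
          (G := fun y => ENNReal.ofReal (youngFun p (κ * q) (u y))) (by fun_prop) hr.ne' x
        rw [abs_of_pos (by positivity)] at h
        gcongr
        exact h
    _ = ENNReal.ofReal A +
        ENNReal.ofReal (A ^ (1 - q) * (r ^ finrank ℝ V)⁻¹) * (c * expInt p (κ * q) u) := by
        rw [ENNReal.ofReal_mul (by positivity)]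
        ring
    _ = _ := by rw [hbalance]; ring

end Average

/-! ### The Orlicz heart -/

lemma tendsto_luxNorm_zero_iff {n : ℕ} {ι : Type*} {F : Filter ι} {p : ℝ} (hp : 0 < p)
    {h : ι → E n → ℝ} :
    Tendsto (fun i => luxNorm p (h i)) F (𝓝 0) ↔
      ∀ μ : ℝ, 0 < μ → ∀ᶠ i in F, expInt p μ (h i) ≤ 1 := by
  refine ⟨fun H μ hμ => ?_, fun H => ENNReal.tendsto_nhds_zero.2 fun ε hε => ?_⟩
  · set l := (μ⁻¹) ^ (1 / p) with hl
    have hlp : l ^ p = μ⁻¹ := by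
      rw [hl, ← Real.rpow_mul (by positivity), one_div_mul_cancel hp.ne', Real.rpow_one]
    have hl0 : 0 < l := by positivity
    filter_upwards [H.eventually_lt_const (ENNReal.ofReal_pos.2 hl0)] with i hi
    simp only [luxNorm, iInf_lt_iff] at hi
    obtain ⟨l', hl'0, hmod, hlt⟩ := hi
    rw [modular_eq_expInt] at hmod
    refine (expInt_mono ?_ _).trans hmod
    have hle : l' ≤ l := ((ENNReal.ofReal_lt_ofReal_iff hl0).1 hlt).le
    rw [← inv_inv μ, ← hlp]
    gcongr
  · obtain ⟨l, _, hl0, hlε⟩ := ENNReal.lt_iff_exists_real_btwn.1 hε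
    rw [ENNReal.ofReal_pos] at hl0
    filter_upwards [H (l ^ p)⁻¹ (by positivity)] with i hi
    rw [← modular_eq_expInt] at hi
    exact (iInf₂_le_of_le l hl0 (iInf_le_of_le hi le_rfl)).trans hlε.le

/-- Membership in the Orlicz heart: all exponential integrals of `u` are finite. On `ℝⁿ` this
characterizes the closure `exp L^p_0` of the smooth compactly supported functions. -/
def IsHeart {α : Type*} [MeasurableSpace α] (p : ℝ) (u : α → ℝ)
    (ν : Measure α := by volume_tac) : Prop :=
  ∀ μ : ℝ, 0 < μ → expInt p μ u ν ≠ ⊤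

/-- The function equal to `u` where `|u| ≤ N` and to `0` elsewhere. -/
def trunc {α : Type*} (N : ℝ) (u : α → ℝ) (x : α) : ℝ := if |u x| ≤ N then u x else 0

lemma abs_trunc_le {α : Type*} {N : ℝ} (hN : 0 ≤ N) (u : α → ℝ) (x : α) : |trunc N u x| ≤ N := by
  unfold trunc
  split_ifs with h <;> simp [h, hN]

lemma abs_trunc_le_abs {α : Type*} (N : ℝ) (u : α → ℝ) (x : α) : |trunc N u x| ≤ |u x| := by
  unfold trunc
  split_ifs <;> simp

lemma abs_sub_trunc_le_abs {α : Type*} (N : ℝ) (u : α → ℝ) (x : α) :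
    |u x - trunc N u x| ≤ |u x| := by
  unfold trunc
  split_ifs <;> simp

section Heart

variable {α : Type*} [MeasurableSpace α] {ν : Measure α} {p μ N : ℝ} {u v : α → ℝ}

lemma IsHeart.lpInt_ne_top (hp : 0 ≤ p) (hu : IsHeart p u ν) : lpInt p u ν ≠ ⊤ :=
  lpInt_ne_top_of_expInt hp one_pos (hu 1 one_pos)

lemma expInt_le_of_abs_le (hp : 0 < p) (hμ : 0 ≤ μ) (hu : ∀ x, |u x| ≤ N) :
    expInt p μ u ν ≤ ENNReal.ofReal (Real.exp (μ * 2 ^ p * N ^ p)) *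
      (ENNReal.ofReal (μ * 2 ^ p) * lpInt p u ν) := by
  have := expInt_add_le_of_abs_le (ν := ν) (u := fun _ => 0) hp.le hμ measurable_const hu
  simpa only [zero_add, expInt_zero hp.ne'] using this

lemma isHeart_of_abs_le (hp : 0 < p) (hu : ∀ x, |u x| ≤ N) (hi : lpInt p u ν ≠ ⊤) :
    IsHeart p u ν := fun μ hμ =>
  ne_top_of_le_ne_top (by finiteness) (expInt_le_of_abs_le hp hμ.le hu)

lemma memLp_iff_lpInt_ne_top (hp : 0 < p) (hu : AEStronglyMeasurable u ν) :
    MemLp u (ENNReal.ofReal p) ν ↔ lpInt p u ν ≠ ⊤ := by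
  rw [MemLp, and_iff_right hu, eLpNorm_lt_top_iff_lintegral_rpow_enorm_lt_top (by simpa using hp)
    ENNReal.ofReal_ne_top, ENNReal.toReal_ofReal hp.le, lpInt, lt_top_iff_ne_top]

lemma lpInt_eq_eLpNorm_rpow (hp : 0 < p) (u : α → ℝ) :
    lpInt p u ν = eLpNorm u (ENNReal.ofReal p) ν ^ p := by
  rw [eLpNorm_eq_lintegral_rpow_enorm_toReal (by simpa using hp) ENNReal.ofReal_ne_top,
    ENNReal.toReal_ofReal hp.le, ← ENNReal.rpow_mul, one_div_mul_cancel hp.ne', ENNReal.rpow_one,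
    lpInt]

lemma lpInt_mono (hp : 0 ≤ p) (h : ∀ x, |u x| ≤ |v x|) : lpInt p u ν ≤ lpInt p v ν :=
  lintegral_mono fun x => ENNReal.rpow_le_rpow (enorm_le_iff_norm_le.2 (h x)) hp

lemma lpInt_comp_sub_le (hp : 0 ≤ p) {χ : ℝ → ℝ} {L : ℝ≥0} (hχ : LipschitzWith L χ)
    (u v : α → ℝ) :
    lpInt p (fun x => χ (u x) - χ (v x)) ν ≤ (L : ℝ≥0∞) ^ p * lpInt p (fun x => u x - v x) ν := by
  rw [lpInt, lpInt, ← lintegral_const_mul' _ _ (by finiteness)]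
  refine lintegral_mono fun x => ?_
  rw [← ENNReal.mul_rpow_of_nonneg _ _ hp, ← edist_eq_enorm_sub, ← edist_eq_enorm_sub]
  exact ENNReal.rpow_le_rpow (hχ (u x) (v x)) hp

lemma measurable_trunc (N : ℝ) (hu : Measurable u) : Measurable (trunc N u) :=
  Measurable.ite (measurableSet_le (by fun_prop) measurable_const) hu measurable_const

lemma exists_expInt_sub_trunc_le (hp : 0 < p) (hμ : 0 < μ) (hu : Measurable u)
    (hh : IsHeart p u ν) {ε : ℝ≥0∞} (hε : 0 < ε) :
    ∃ N : ℝ, 0 ≤ N ∧ expInt p μ (fun x => u x - trunc N u x) ν ≤ ε := by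
  have hlim : Tendsto (fun N : ℕ => expInt p μ (fun x => u x - trunc N u x) ν) atTop
      (𝓝 (∫⁻ _, 0 ∂ν)) := by
    refine tendsto_lintegral_of_dominated_convergence
      (fun x => ENNReal.ofReal (youngFun p μ (u x)))
      (fun N => by have := measurable_trunc (N : ℝ) hu; fun_prop)
      (fun N => Eventually.of_forall fun x => ENNReal.ofReal_le_ofReal ?_) (hh μ hμ)
      (Eventually.of_forall fun x => ?_)
    · exact youngFun_le_of_abs_le hp.le hμ.le (abs_sub_trunc_le_abs _ u x)
    · obtain ⟨N, hN⟩ := exists_nat_ge |u x|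
      refine tendsto_const_nhds.congr' ?_
      filter_upwards [eventually_ge_atTop N] with k hk
      have : |u x| ≤ k := hN.trans (by exact_mod_cast hk)
      simp [trunc, this, youngFun_zero hp.ne']
  rw [lintegral_zero] at hlim
  obtain ⟨N, hN⟩ := (ENNReal.tendsto_nhds_zero.1 hlim ε hε).exists
  exact ⟨N, N.cast_nonneg, hN⟩

end Heart

lemma isHeart_of_mem_expLZero {n : ℕ} {p : ℝ} (hp : 0 < p) {u : Fn n} (hu : u ∈ expLZero n p) :
    IsHeart p u := by
  obtain ⟨-, φ, hφ, hlim⟩ := hu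
  intro μ hμ
  obtain ⟨k, hk⟩ := ((tendsto_luxNorm_zero_iff hp).1 hlim (μ * 2 ^ p) (by positivity)).exists
  have hc := (hφ k).1.continuous
  obtain ⟨M, hM⟩ := (hφ k).2.exists_bound_of_continuous hc
  have hφk : IsHeart p (φ k) := isHeart_of_abs_le hp hM
    ((memLp_iff_lpInt_ne_top hp hc.aestronglyMeasurable).1
      (hc.memLp_of_hasCompactSupport (hφ k).2))
  have hle := expInt_sub_le (ν := volume) hp.le hμ.le hc.measurable fun x => φ k x - u x
  simp only [sub_sub_cancel] at hle
  exact ne_top_of_le_ne_top (ENNReal.add_ne_top.2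
    ⟨hφk _ (by positivity), ne_top_of_le_ne_top ENNReal.one_ne_top hk⟩) hle

lemma exists_smooth_clip {N : ℝ} (hN : 0 ≤ N) :
    ∃ χ : ℝ → ℝ, ContDiff ℝ ((⊤ : ℕ∞) : WithTop ℕ∞) χ ∧ (∀ y, |y| ≤ N → χ y = y) ∧
      (∀ y, |χ y| ≤ N + 2) ∧ ∃ L : ℝ≥0, LipschitzWith L χ := by
  let b : ContDiffBump (0 : ℝ) := ⟨N + 1, N + 2, by linarith, by linarith⟩
  have hsm : ContDiff ℝ ((⊤ : ℕ∞) : WithTop ℕ∞) fun y => y * b y := contDiff_id.mul b.contDiff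
  refine ⟨fun y => y * b y, hsm, fun y hy => ?_, fun y => ?_,
    hsm.lipschitzWith_of_hasCompactSupport b.hasCompactSupport.mul_left (by simp)⟩
  · dsimp only
    rw [b.one_of_mem_closedBall, mul_one]
    rw [Metric.mem_closedBall, dist_zero_right, Real.norm_eq_abs]
    exact hy.trans (le_add_of_nonneg_right zero_le_one)
  · by_cases h : |y| ≤ N + 2
    · rw [abs_mul, abs_of_nonneg b.nonneg]
      exact (mul_le_of_le_one_right (abs_nonneg y) b.le_one).trans h
    · dsimp only
      rw [b.zero_of_le_dist, mul_zero, abs_zero]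
      · linarith
      · rw [dist_zero_right, Real.norm_eq_abs]
        exact (not_le.1 h).le

section Density

variable {V : Type*} [NormedAddCommGroup V] [NormedSpace ℝ V] [FiniteDimensional ℝ V]
  [MeasurableSpace V] [BorelSpace V] {ν : Measure V} [IsFiniteMeasureOnCompacts ν]
  {p μ : ℝ} {u : V → ℝ}

lemma exists_smooth_lpInt_sub_le (hp : 1 ≤ p) (hu : AEStronglyMeasurable u ν)
    (hi : lpInt p u ν ≠ ⊤) {ε : ℝ≥0∞} (hε : 0 < ε) :
    ∃ g : V → ℝ, ContDiff ℝ ((⊤ : ℕ∞) : WithTop ℕ∞) g ∧ HasCompactSupport g ∧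
      lpInt p (fun x => u x - g x) ν ≤ ε := by
  have hp0 : 0 < p := by linarith
  obtain ⟨δ, -, hδ0, hδ⟩ := ENNReal.lt_iff_exists_real_btwn.1
    (ENNReal.rpow_pos_of_nonneg hε (one_div_nonneg.2 hp0.le))
  obtain ⟨g, hgc, hgs, hge⟩ := ((memLp_iff_lpInt_ne_top hp0 hu).2 hi).exist_eLpNorm_sub_le
    ENNReal.ofReal_ne_top (by simpa using hp) (ENNReal.ofReal_pos.1 hδ0)
  refine ⟨g, hgs, hgc, ?_⟩
  rw [lpInt_eq_eLpNorm_rpow hp0]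
  refine (ENNReal.rpow_le_rpow (hge.trans hδ.le) hp0.le).trans_eq ?_
  rw [← ENNReal.rpow_mul, one_div_mul_cancel hp0.ne', ENNReal.rpow_one]

lemma exists_smooth_abs_le_lpInt_sub_le {N : ℝ} (hp : 1 ≤ p) (hu : AEStronglyMeasurable u ν)
    (hi : lpInt p u ν ≠ ⊤) (hN : 0 ≤ N) (huN : ∀ x, |u x| ≤ N) {ε : ℝ≥0∞} (hε : 0 < ε) :
    ∃ φ : V → ℝ, ContDiff ℝ ((⊤ : ℕ∞) : WithTop ℕ∞) φ ∧ HasCompactSupport φ ∧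
      (∀ x, |φ x| ≤ N + 2) ∧ lpInt p (fun x => u x - φ x) ν ≤ ε := by
  have hp0 : 0 ≤ p := by linarith
  obtain ⟨χ, hχ, hχid, hχb, L, hL⟩ := exists_smooth_clip hN
  obtain ⟨g, hgs, hgc, hge⟩ := exists_smooth_lpInt_sub_le hp hu hi
    (ENNReal.div_pos hε.ne' (show (L : ℝ≥0∞) ^ p ≠ ⊤ by finiteness))
  refine ⟨χ ∘ g, hχ.comp hgs, hgc.comp_left (hχid 0 (by simpa using hN)), fun x => hχb _, ?_⟩
  calc lpInt p (fun x => u x - χ (g x)) ν = lpInt p (fun x => χ (u x) - χ (g x)) ν := by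
        simp only [hχid _ (huN _)]
    _ ≤ (L : ℝ≥0∞) ^ p * lpInt p (fun x => u x - g x) ν := lpInt_comp_sub_le hp0 hL u g
    _ ≤ (L : ℝ≥0∞) ^ p * (ε / (L : ℝ≥0∞) ^ p) := by gcongr
    _ ≤ ε := ENNReal.mul_div_le

lemma exists_smooth_expInt_sub_le (hp : 1 ≤ p) (hμ : 0 < μ) (hu : Measurable u)
    (hh : IsHeart p u ν) :
    ∃ φ : V → ℝ, ContDiff ℝ ((⊤ : ℕ∞) : WithTop ℕ∞) φ ∧ HasCompactSupport φ ∧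
      expInt p μ (fun x => φ x - u x) ν ≤ 1 := by
  have hp0 : 0 < p := by linarith
  have hμ2 : 0 < μ * 2 ^ p := by positivity
  obtain ⟨N, hN, hNe⟩ := exists_expInt_sub_trunc_le hp0 hμ2 hu hh 
    (ENNReal.inv_pos.2 (ENNReal.ofNat_ne_top (n := 2)))
  have hv := measurable_trunc N hu
  set K := ENNReal.ofReal (Real.exp (μ * 2 ^ p * 2 ^ p * (N + (N + 2)) ^ p)) *
    ENNReal.ofReal (μ * 2 ^ p * 2 ^ p) with hK
  obtain ⟨φ, hφs, hφc, hφb, hφe⟩ := exists_smooth_abs_le_lpInt_sub_le hp hv.aestronglyMeasurable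
    (ne_top_of_le_ne_top (hh.lpInt_ne_top hp0.le) (lpInt_mono hp0.le (abs_trunc_le_abs N u)))
    hN (abs_trunc_le hN u)
    (ENNReal.div_pos (by simp : (2⁻¹ : ℝ≥0∞) ≠ 0) (show K ≠ ⊤ by rw [hK]; finiteness))
  refine ⟨φ, hφs, hφc, ?_⟩
  have hbdd : expInt p (μ * 2 ^ p) (fun x => trunc N u x - φ x) ν ≤ 2⁻¹ := by
    refine (expInt_le_of_abs_le hp0 hμ2.le fun x => (abs_sub _ _).trans
      (add_le_add (abs_trunc_le hN u x) (hφb x))).trans ?_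
    rw [← mul_assoc, ← hK]
    exact (mul_le_mul_right hφe K).trans ENNReal.mul_div_le
  have hadd := expInt_add_le (ν := ν) hp0.le hμ.le (hu.sub hv) fun x => trunc N u x - φ x
  simp only [Pi.sub_apply, sub_add_sub_cancel] at hadd
  rw [expInt_sub_comm, ← ENNReal.inv_two_add_inv_two]
  exact hadd.trans (add_le_add hNe hbdd)

end Density

lemma mem_expLZero_of_isHeart {n : ℕ} {p : ℝ} (hp : 1 ≤ p) {u : Fn n} (hu : IsHeart p u) :
    u ∈ expLZero n p := by
  have hp0 : 0 < p := by linarith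
  have hlp := (memLp_iff_lpInt_ne_top hp0 u.aestronglyMeasurable).2 (hu.lpInt_ne_top hp0.le)
  refine ⟨⟨hlp.locallyIntegrable (by simpa using hp), 1, one_pos, ?_⟩, ?_⟩
  · rw [modular_eq_expInt]
    exact (hu _ (by positivity)).lt_top
  · choose φ hφs hφc hφe using fun k : ℕ =>
      exists_smooth_expInt_sub_le hp (show (0 : ℝ) < k + 1 by positivity) u.measurable hu
    refine ⟨φ, fun k => ⟨hφs k, hφc k⟩, (tendsto_luxNorm_zero_iff hp0).2 fun μ _ => ?_⟩
    obtain ⟨N, hN⟩ := exists_nat_ge μ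
    filter_upwards [eventually_ge_atTop N] with k hk
    refine (expInt_mono ?_ _).trans (hφe k)
    have : (N : ℝ) ≤ k := by exact_mod_cast hk
    linarith

/-! ### Continuity of translations and of averages -/

lemma tendsto_lpInt_translate_sub {V : Type*} [NormedAddCommGroup V] [ProperSpace V]
    [MeasurableSpace V] [BorelSpace V] (ν : Measure V) [ν.IsAddHaarMeasure] {p : ℝ} (hp : 1 ≤ p)
    {h : V → ℝ} (hh : MemLp h (ENNReal.ofReal p) ν) :
    Tendsto (fun y => lpInt p (fun x => h (x + y) - h x) ν) (𝓝 0) (𝓝 0) := by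
  have hp0 : 0 < p := by linarith
  have : Fact (1 ≤ ENNReal.ofReal p) := ⟨by simpa using hp⟩
  let G : C(V, C(V, V)) := (ContinuousMap.mk (fun q : V × V => q.2 + q.1)
    (by fun_prop)).curry
  have hG : ∀ y, MeasurePreserving (G y) ν ν := fun y => measurePreserving_add_right ν y
  have hlim := (tendsto_const_nhds (x := hh.toLp h) (f := 𝓝 (0 : V))).compMeasurePreservingLp
    (g := G) (G.continuous.tendsto 0) hG (hG 0) ENNReal.ofReal_ne_top
  have hzero : Lp.compMeasurePreserving (G 0) (hG 0) (hh.toLp h) = hh.toLp h := by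
    refine Lp.ext ((Lp.coeFn_compMeasurePreserving _ (hG 0)).trans ?_)
    exact Eventually.of_forall fun x => by simp [G]
  rw [hzero, tendsto_iff_edist_tendsto_0] at hlim
  have hpow := ((ENNReal.continuous_rpow_const (y := p)).tendsto 0).comp hlim
  rw [ENNReal.zero_rpow_of_pos hp0] at hpow
  refine hpow.congr fun y => ?_
  rw [Function.comp_apply, Lp.edist_def, lpInt_eq_eLpNorm_rpow hp0]
  congr 1
  refine eLpNorm_congr_ae ?_
  filter_upwards [Lp.coeFn_compMeasurePreserving (hh.toLp h) (hG y), hh.coeFn_toLp,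
    (hG y).quasiMeasurePreserving.ae_eq_comp hh.coeFn_toLp] with x hcomp hx hxy
  simp only [Pi.sub_apply, hcomp, hx, hxy]
  rfl

lemma lpInt_sub_le {α : Type*} [MeasurableSpace α] {ν : Measure α} {p : ℝ} (hp : 1 ≤ p)
    {u : α → ℝ} (hu : Measurable u) (v : α → ℝ) :
    lpInt p (fun x => u x - v x) ν ≤ 2 ^ (p - 1) * (lpInt p u ν + lpInt p v ν) := by
  rw [lpInt, lpInt, lpInt, ← lintegral_add_left (by fun_prop),
    ← lintegral_const_mul' _ _ (ENNReal.rpow_ne_top_of_nonneg (by linarith) (by simp))]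
  exact lintegral_mono fun x => (ENNReal.rpow_le_rpow enorm_sub_le (by linarith)).trans
    (ENNReal.rpow_add_le_mul_rpow_add_rpow _ _ hp)

lemma lpInt_integral_le {α Ω : Type*} [MeasurableSpace α] [MeasurableSpace Ω] {ν : Measure α}
    [SFinite ν] {P : Measure Ω} [SFinite P] (hP : P univ ≤ 1) {p : ℝ} (hp : 1 ≤ p)
    {F : α → Ω → ℝ} (hF : Measurable (Function.uncurry F)) :
    lpInt p (fun x => ∫ ω, F x ω ∂P) ν ≤ ∫⁻ ω, lpInt p (fun x => F x ω) ν ∂P := by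
  have hG : Measurable fun y : α × Ω => ‖F y.1 y.2‖ₑ ^ p := (hF.enorm).pow_const p
  calc lpInt p (fun x => ∫ ω, F x ω ∂P) ν ≤ ∫⁻ x, ∫⁻ ω, ‖F x ω‖ₑ ^ p ∂P ∂ν :=
        lintegral_mono fun x =>
          (ENNReal.rpow_le_rpow (enorm_integral_le_lintegral_enorm _) (by linarith)).trans
            (rpow_lintegral_le hP hp (hF.of_uncurry_left.enorm.aemeasurable))
    _ = ∫⁻ ω, lpInt p (fun x => F x ω) ν ∂P := lintegral_lintegral_swap hG.aemeasurable

lemma abs_avg_le {V : Type*} [NormedAddCommGroup V] [InnerProductSpace ℝ V] [MeasurableSpace V]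
    {P : Measure V} [IsProbabilityMeasure P] {u : V → ℝ} {M : ℝ} (hu : ∀ y, |u y| ≤ M) (r : ℝ)
    (x : V) : |avg P r u x| ≤ M := by
  have := norm_integral_le_of_norm_le_const (μ := P)
    (f := fun z => u (x - r • z)) (C := M) (Eventually.of_forall fun z => hu _)
  simpa [avg] using this

section Average

variable {V : Type*} [NormedAddCommGroup V] [InnerProductSpace ℝ V] [FiniteDimensional ℝ V]
  [MeasurableSpace V] [BorelSpace V] {P : Measure V} {p μ : ℝ} {c : ℝ≥0} {u v : V → ℝ}

lemma measurable_avg_right [SFinite P] (r : ℝ) (hu : Measurable u) : Measurable (avg P r u) :=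
  measurable_avg (g := fun _ => u) (hu.comp measurable_snd) measurable_const measurable_id

lemma integrable_sub_smul_of_lpInt [IsProbabilityMeasure P] (hP : P ≤ (c : ℝ≥0∞) • volume)
    (hp : 1 ≤ p) (hu : Measurable u) (hi : lpInt p u ≠ ⊤) (r : ℝ) (x : V) :
    Integrable (fun z => u (x - r • z)) P := by
  rcases eq_or_ne r 0 with rfl | hr
  · simp
  have hm : Measurable fun z => u (x - r • z) := by fun_prop
  refine ((memLp_iff_lpInt_ne_top (by linarith) hm.aestronglyMeasurable).2
    (ne_top_of_le_ne_top ?_ (lintegral_sub_smul_le hP (G := fun y => ‖u y‖ₑ ^ p) (by fun_prop)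
      hr x))).integrable (by simpa using hp)
  rw [lpInt] at hi
  finiteness

lemma avg_add [IsProbabilityMeasure P] (hP : P ≤ (c : ℝ≥0∞) • volume) (hp : 1 ≤ p)
    (hu : Measurable u) (hiu : lpInt p u ≠ ⊤) (hv : Measurable v) (hiv : lpInt p v ≠ ⊤) (r : ℝ)
    (x : V) : avg P r (fun y => u y + v y) x = avg P r u x + avg P r v x :=
  integral_add (integrable_sub_smul_of_lpInt hP hp hu hiu r x)
    (integrable_sub_smul_of_lpInt hP hp hv hiv r x)

lemma lpInt_avg_sub_avg_le [IsProbabilityMeasure P] (hP : P ≤ (c : ℝ≥0∞) • volume) (hp : 1 ≤ p)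
    (hu : Measurable u) (hi : lpInt p u ≠ ⊤) (r r₀ : ℝ) :
    lpInt p (fun x => avg P r u x - avg P r₀ u x) ≤
      ∫⁻ z, lpInt p (fun x => u (x + (r₀ - r) • z) - u x) ∂P := by
  have hsub : (fun x => avg P r u x - avg P r₀ u x) =
      fun x => ∫ z, (u (x - r • z) - u (x - r₀ • z)) ∂P := funext fun x =>
    (integral_sub (integrable_sub_smul_of_lpInt hP hp hu hi r x)
      (integrable_sub_smul_of_lpInt hP hp hu hi r₀ x)).symm
  rw [hsub]
  refine (lpInt_integral_le (by simp) hp (by unfold Function.uncurry; fun_prop)).trans_eq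
    (lintegral_congr fun z => ?_)
  refine Eq.trans (lintegral_congr fun x => ?_) (lintegral_sub_right_eq_self
    (fun x => ‖u (x + (r₀ - r) • z) - u x‖ₑ ^ p) (r₀ • z))
  simp only [sub_smul, sub_add_sub_cancel]

lemma tendsto_lpInt_avg_sub [IsProbabilityMeasure P] (hP : P ≤ (c : ℝ≥0∞) • volume) (hp : 1 ≤ p)
    (hu : Measurable u) (hi : lpInt p u ≠ ⊤) (r₀ : ℝ) :
    Tendsto (fun r => lpInt p (fun x => avg P r u x - avg P r₀ u x)) (𝓝 r₀) (𝓝 0) := by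
  set D : V → ℝ≥0∞ := fun y => lpInt p fun x => u (x + y) - u x
  have hDm : Measurable D := by
    have : Measurable fun q : V × V => ‖u (q.2 + q.1) - u q.2‖ₑ ^ p := by fun_prop
    exact this.lintegral_prod_right'
  have hDle : ∀ y, D y ≤ 2 ^ (p - 1) * (lpInt p u + lpInt p u) := fun y => by
    have htrans : lpInt p (fun x => u (x + y)) = lpInt p u :=
      lintegral_add_right_eq_self (fun x => ‖u x‖ₑ ^ p) y
    have h := lpInt_sub_le (ν := volume) hp (show Measurable fun x => u (x + y) by fun_prop) u
    rwa [htrans] at h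
  have hlim : Tendsto (fun r : ℝ => ∫⁻ z, D ((r₀ - r) • z) ∂P) (𝓝 r₀) (𝓝 (∫⁻ _, 0 ∂P)) := by
    refine tendsto_lintegral_filter_of_dominated_convergence
      (fun _ => 2 ^ (p - 1) * (lpInt p u + lpInt p u))
      (Eventually.of_forall fun r => hDm.comp (measurable_const_smul _))
      (Eventually.of_forall fun r => Eventually.of_forall fun z => hDle _) ?_
      (Eventually.of_forall fun z => (tendsto_lpInt_translate_sub volume hp
        ((memLp_iff_lpInt_ne_top (by linarith) hu.aestronglyMeasurable).2 hi)).comp ?_)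
    · rw [lintegral_const, measure_univ, mul_one]
      have : p - 1 ≥ 0 := by linarith
      finiteness
    · have hr : Continuous fun r : ℝ => (r₀ - r) • z := by fun_prop
      simpa using hr.tendsto r₀
  rw [lintegral_zero] at hlim
  exact tendsto_of_tendsto_of_tendsto_of_le_of_le tendsto_const_nhds hlim
    (fun _ => zero_le) (fun r => lpInt_avg_sub_avg_le hP hp hu hi r r₀)

lemma tendsto_expInt_of_tendsto_lpInt {ι : Type*} {F : Filter ι} {M : ℝ} (hp : 0 < p)
    (hμ : 0 ≤ μ) {b : ι → V → ℝ} (hb : ∀ i x, |b i x| ≤ M)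
    (h : Tendsto (fun i => lpInt p (b i)) F (𝓝 0)) :
    Tendsto (fun i => expInt p μ (b i)) F (𝓝 0) := by
  refine tendsto_of_tendsto_of_tendsto_of_le_of_le tendsto_const_nhds ?_ (fun _ => zero_le)
    (fun i => expInt_le_of_abs_le hp hμ (hb i))
  simpa using ENNReal.Tendsto.const_mul (ENNReal.Tendsto.const_mul h
    (Or.inr ENNReal.ofReal_ne_top)) (Or.inr ENNReal.ofReal_ne_top)

lemma expInt_avg_sub_avg_le [IsProbabilityMeasure P] (hP : P ≤ (c : ℝ≥0∞) • volume) (hp : 1 ≤ p)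
    (hμ : 0 ≤ μ) (hu : Measurable u) (hiu : lpInt p u ≠ ⊤) (hv : Measurable v)
    (hiv : lpInt p v ≠ ⊤) (r r₀ : ℝ) :
    expInt p μ (fun x => avg P r (fun y => u y + v y) x - avg P r₀ (fun y => u y + v y) x) ≤
      expInt p (μ * 2 ^ p * 2 ^ p) u + expInt p (μ * 2 ^ p * 2 ^ p) u +
        expInt p (μ * 2 ^ p) (fun x => avg P r v x - avg P r₀ v x) := by
  have hp0 : 0 ≤ p := by linarith
  simp only [avg_add hP hp hu hiu hv hiv, add_sub_add_comm]
  have hm := fun r => measurable_avg_right (P := P) r hu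
  refine (expInt_add_le hp0 hμ ((hm r).sub (hm r₀)) _).trans (add_le_add_left ?_ _)
  refine (expInt_sub_le hp0 (by positivity) (hm r) _).trans ?_
  gcongr <;> exact expInt_avg_le hp (by positivity) hu _

lemma tendsto_expInt_avg_sub [IsProbabilityMeasure P] (hP : P ≤ (c : ℝ≥0∞) • volume) (hp : 1 ≤ p)
    (hμ : 0 < μ) (hu : Measurable u) (hh : IsHeart p u) (r₀ : ℝ) :
    Tendsto (fun r => expInt p μ (fun x => avg P r u x - avg P r₀ u x)) (𝓝 r₀) (𝓝 0) := by
  have hp0 : 0 < p := by linarith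
  refine ENNReal.tendsto_nhds_zero.2 fun ε hε => ?_
  have hε3 : 0 < ε / 3 := ENNReal.div_pos hε.ne' ENNReal.ofNat_ne_top
  obtain ⟨N, hN, hNe⟩ := exists_expInt_sub_trunc_le hp0
    (show 0 < μ * 2 ^ p * 2 ^ p by positivity) hu hh hε3
  have hv := measurable_trunc N hu
  have hiu := hh.lpInt_ne_top hp0.le
  have hiv := ne_top_of_le_ne_top hiu (lpInt_mono hp0.le (abs_trunc_le_abs N u))
  have hiw := ne_top_of_le_ne_top hiu (lpInt_mono hp0.le (abs_sub_trunc_le_abs N u))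
  have hlim := tendsto_expInt_of_tendsto_lpInt hp0 (show 0 ≤ μ * 2 ^ p by positivity)
    (fun r x => (abs_sub _ _).trans (add_le_add (abs_avg_le (abs_trunc_le hN u) r x)
      (abs_avg_le (abs_trunc_le hN u) r₀ x))) (tendsto_lpInt_avg_sub hP hp hv hiv r₀)
  filter_upwards [ENNReal.tendsto_nhds_zero.1 hlim _ hε3] with r hr
  have hle := expInt_avg_sub_avg_le hP hp hμ.le (hu.sub hv) hiw hv hiv r r₀
  simp only [Pi.sub_apply, sub_add_cancel] at hle
  rw [← ENNReal.add_thirds ε]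
  exact hle.trans (add_le_add (add_le_add hNe hNe) hr)

end Average

/-! ### The nonlinearity -/

lemma abs_integral_le_of_lintegral {α : Type*} [MeasurableSpace α] {P : Measure α} {g : α → ℝ}
    {K : ℝ} (hK : 0 ≤ K) (h : ∫⁻ a, ‖g a‖ₑ ∂P ≤ ENNReal.ofReal K) : |∫ a, g a ∂P| ≤ K := by
  have := (enorm_integral_le_lintegral_enorm g).trans h
  rwa [Real.enorm_eq_ofReal_abs, ENNReal.ofReal_le_ofReal_iff hK] at this

/-- The assumptions on the nonlinearity `f`: it vanishes at the origin and is locally Lipschitz with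
constants growing like `e^{lam |·|^p}`. -/
structure ExpGrowth (p C lam : ℝ) (f : ℝ → ℝ) : Prop where
  one_le : 1 ≤ p
  const_pos : 0 < C
  rate_pos : 0 < lam
  map_zero : f 0 = 0
  lipschitz : ∀ a b : ℝ, |f a - f b| ≤
    C * |a - b| * (Real.exp (lam * |a| ^ p) + Real.exp (lam * |b| ^ p))

namespace ExpGrowth

variable {p C lam : ℝ} {f : ℝ → ℝ}

lemma exponent_pos (hf : ExpGrowth p C lam f) : 0 < p := by linarith [hf.one_le]

lemma continuous (hf : ExpGrowth p C lam f) : Continuous f := by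
  refine continuous_iff_continuousAt.2 fun b => tendsto_iff_norm_sub_tendsto_zero.2 ?_
  have hpow : Continuous fun y : ℝ => |y| ^ p :=
    continuous_abs.rpow_const fun _ => Or.inr hf.exponent_pos.le
  have hbound : Continuous fun a : ℝ =>
      C * |a - b| * (Real.exp (lam * |a| ^ p) + Real.exp (lam * |b| ^ p)) := by
    fun_prop
  refine squeeze_zero (fun a => norm_nonneg _) (fun a => hf.lipschitz a b) ?_
  simpa using hbound.tendsto b

lemma abs_le (hf : ExpGrowth p C lam f) (y : ℝ) :
    |f y| ≤ 2 * C * |y| * Real.exp (lam * |y| ^ p) := by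
  have hlip := hf.lipschitz y 0
  rw [hf.map_zero, sub_zero, sub_zero, abs_zero, Real.zero_rpow hf.exponent_pos.ne', mul_zero,
    Real.exp_zero] at hlip
  have hC := hf.const_pos
  have hl := hf.rate_pos
  have hexp : 1 ≤ Real.exp (lam * |y| ^ p) := Real.one_le_exp (by positivity)
  have hCy : 0 ≤ C * |y| := by positivity
  nlinarith

lemma abs_le_exp (hf : ExpGrowth p C lam f) (y : ℝ) :
    |f y| ≤ 2 * C * (1 + lam⁻¹) * Real.exp (2 * lam * |y| ^ p) := by
  have hC := hf.const_pos
  have hl := hf.rate_pos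
  have hexp : 1 ≤ Real.exp (lam * |y| ^ p) := Real.one_le_exp (by positivity)
  have hy : |y| ≤ 1 + |y| ^ p := by
    rcases le_total |y| 1 with h | h
    · linarith [show 0 ≤ |y| ^ p by positivity]
    · linarith [Real.self_le_rpow_of_one_le h hf.one_le]
  have hpow : |y| ^ p ≤ lam⁻¹ * Real.exp (lam * |y| ^ p) := by
    rw [le_inv_mul_iff₀ hl]
    linarith [Real.add_one_le_exp (lam * |y| ^ p)]
  have hyexp : |y| ≤ (1 + lam⁻¹) * Real.exp (lam * |y| ^ p) := by linarith
  calc |f y| ≤ 2 * C * |y| * Real.exp (lam * |y| ^ p) := hf.abs_le y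
    _ ≤ 2 * C * ((1 + lam⁻¹) * Real.exp (lam * |y| ^ p)) * Real.exp (lam * |y| ^ p) := by gcongr
    _ = 2 * C * (1 + lam⁻¹) * Real.exp (lam * |y| ^ p + lam * |y| ^ p) := by
        rw [Real.exp_add]; ring
    _ = 2 * C * (1 + lam⁻¹) * Real.exp (2 * lam * |y| ^ p) := by ring_nf

lemma abs_rpow_le (hf : ExpGrowth p C lam f) (y : ℝ) :
    |f y| ^ p ≤ (2 * C) ^ p * youngFun p (lam * p + 1) y := by
  have hp := hf.exponent_pos
  have hC := hf.const_pos
  have hl := hf.rate_pos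
  have hexp : 1 ≤ Real.exp (lam * p * |y| ^ p) := Real.one_le_exp (by positivity)
  calc |f y| ^ p ≤ (2 * C * |y| * Real.exp (lam * |y| ^ p)) ^ p :=
        Real.rpow_le_rpow (abs_nonneg _) (hf.abs_le y) hp.le
    _ = (2 * C) ^ p * (Real.exp (lam * p * |y| ^ p) * |y| ^ p) := by
        rw [Real.mul_rpow (by positivity) (by positivity),
          Real.mul_rpow (by positivity) (by positivity), ← Real.exp_mul]
        ring_nf
    _ ≤ (2 * C) ^ p * (Real.exp (lam * p * |y| ^ p) * Real.exp (|y| ^ p) - 1) := by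
        gcongr
        nlinarith [Real.add_one_le_exp (|y| ^ p)]
    _ = (2 * C) ^ p * youngFun p (lam * p + 1) y := by
        rw [youngFun, ← Real.exp_add, add_mul, one_mul]

lemma abs_sub_le (hf : ExpGrowth p C lam f) (a b : ℝ) :
    |f a - f b| ≤ |a - b| * (C * (1 + lam⁻¹) * (Real.exp (2 * lam * |a| ^ p) +
      Real.exp (2 * lam * |b| ^ p))) := by
  have hC := hf.const_pos
  have hl := hf.rate_pos
  calc |f a - f b| ≤ C * |a - b| * (Real.exp (lam * |a| ^ p) + Real.exp (lam * |b| ^ p)) :=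
        hf.lipschitz a b
    _ = |a - b| * (C * 1 * (Real.exp (1 * lam * |a| ^ p) + Real.exp (1 * lam * |b| ^ p))) := by
        ring_nf
    _ ≤ _ := by
        gcongr
        · exact le_add_of_nonneg_right (by positivity)
        · norm_num
        · norm_num

section Nemytskii

variable {α : Type*} [MeasurableSpace α] {P : Measure α} {u v : α → ℝ} {A : ℝ}

lemma lpInt_comp_le (hf : ExpGrowth p C lam f) (u : α → ℝ) :
    lpInt p (fun a => f (u a)) P ≤
      ENNReal.ofReal ((2 * C) ^ p) * expInt p (lam * p + 1) u P := by
  have hC := hf.const_pos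
  rw [lpInt, expInt, ← lintegral_const_mul' _ _ ENNReal.ofReal_ne_top]
  refine lintegral_mono fun a => ?_
  simp only
  rw [enorm_rpow_eq_ofReal hf.exponent_pos.le, ← ENNReal.ofReal_mul (by positivity)]
  exact ENNReal.ofReal_le_ofReal (hf.abs_rpow_le _)

lemma lintegral_enorm_comp_le (hf : ExpGrowth p C lam f)
    (hA : ∫⁻ a, ENNReal.ofReal (Real.exp (2 * lam * |u a| ^ p)) ∂P ≤ ENNReal.ofReal A) :
    ∫⁻ a, ‖f (u a)‖ₑ ∂P ≤ ENNReal.ofReal (2 * C * (1 + lam⁻¹) * A) := by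
  have hC := hf.const_pos
  have hl := hf.rate_pos
  have hK : 0 ≤ 2 * C * (1 + lam⁻¹) := by positivity
  rw [ENNReal.ofReal_mul hK]
  refine le_trans ?_ (mul_le_mul_right hA _)
  rw [← lintegral_const_mul' _ _ ENNReal.ofReal_ne_top]
  refine lintegral_mono fun a => ?_
  simp only
  rw [Real.enorm_eq_ofReal_abs, ← ENNReal.ofReal_mul hK]
  exact ENNReal.ofReal_le_ofReal (hf.abs_le_exp _)

lemma integrable_comp (hf : ExpGrowth p C lam f) (hu : Measurable u)
    (hA : ∫⁻ a, ENNReal.ofReal (Real.exp (2 * lam * |u a| ^ p)) ∂P ≤ ENNReal.ofReal A) :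
    Integrable (fun a => f (u a)) P :=
  ⟨(hf.continuous.measurable.comp hu).aestronglyMeasurable,
    (hf.lintegral_enorm_comp_le hA).trans_lt ENNReal.ofReal_lt_top⟩

lemma abs_integral_comp_le (hf : ExpGrowth p C lam f) (hA0 : 0 ≤ A)
    (hA : ∫⁻ a, ENNReal.ofReal (Real.exp (2 * lam * |u a| ^ p)) ∂P ≤ ENNReal.ofReal A) :
    |∫ a, f (u a) ∂P| ≤ 2 * C * (1 + lam⁻¹) * A := by
  have hC := hf.const_pos
  have hl := hf.rate_pos
  exact abs_integral_le_of_lintegral (by positivity) (hf.lintegral_enorm_comp_le hA)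

lemma abs_integral_comp_sub_le (hf : ExpGrowth p C lam f) (hA0 : 0 ≤ A) (hu : Measurable u)
    (hv : Measurable v)
    (huA : ∫⁻ a, ENNReal.ofReal (Real.exp (2 * lam * |u a| ^ p)) ∂P ≤ ENNReal.ofReal A)
    (hvA : ∫⁻ a, ENNReal.ofReal (Real.exp (2 * lam * |v a| ^ p)) ∂P ≤ ENNReal.ofReal A)
    {δ : ℝ} (hδ : 0 ≤ δ) (huv : ∀ᵐ a ∂P, |u a - v a| ≤ δ) :
    |∫ a, f (u a) ∂P - ∫ a, f (v a) ∂P| ≤ δ * (2 * C * (1 + lam⁻¹) * A) := by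
  have hC := hf.const_pos
  have hl := hf.rate_pos
  rw [← integral_sub (hf.integrable_comp hu huA) (hf.integrable_comp hv hvA)]
  refine abs_integral_le_of_lintegral (by positivity) ?_
  have hK : 0 ≤ δ * (C * (1 + lam⁻¹)) := by positivity
  calc _ ≤ ∫⁻ a, ENNReal.ofReal (δ * (C * (1 + lam⁻¹))) *
        (ENNReal.ofReal (Real.exp (2 * lam * |u a| ^ p)) +
          ENNReal.ofReal (Real.exp (2 * lam * |v a| ^ p))) ∂P := by
        refine lintegral_mono_ae (huv.mono fun a ha => ?_)
        rw [Real.enorm_eq_ofReal_abs, ← ENNReal.ofReal_add (by positivity) (by positivity),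
          ← ENNReal.ofReal_mul hK, mul_assoc δ]
        refine ENNReal.ofReal_le_ofReal ((hf.abs_sub_le _ _).trans ?_)
        gcongr
    _ ≤ ENNReal.ofReal (δ * (C * (1 + lam⁻¹))) * (ENNReal.ofReal A + ENNReal.ofReal A) := by
        rw [lintegral_const_mul' _ _ ENNReal.ofReal_ne_top, lintegral_add_left (by fun_prop)]
        gcongr
    _ = ENNReal.ofReal (δ * (2 * C * (1 + lam⁻¹) * A)) := by
        rw [← ENNReal.ofReal_add hA0 hA0, ← ENNReal.ofReal_mul hK]
        ring_nf

end Nemytskii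

end ExpGrowth

section SmoothingBound

variable {V : Type*} [NormedAddCommGroup V] [InnerProductSpace ℝ V] [FiniteDimensional ℝ V]
  [MeasurableSpace V] [BorelSpace V] {P : Measure V}

/-- The measurable functions `u` with `∫ (e^{μ |u|^p} - 1) ≤ B`. -/
def expBall (V : Type*) [MeasureSpace V] (p μ : ℝ) (B : ℝ≥0) : Set (V → ℝ) :=
  {u | Measurable u ∧ expInt p μ u ≤ B}

lemma expBall_mono {V : Type*} [MeasureSpace V] {p μ : ℝ} {B B' : ℝ≥0} (h : B ≤ B') :
    expBall V p μ B ⊆ expBall V p μ B' :=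
  fun _ hw => ⟨hw.1, hw.2.trans (ENNReal.coe_le_coe.2 h)⟩

/-- Smoothing of the nonlinear source: for `u` and `v` in `S`, the averages of `f ∘ u` at time
`σ ≤ 1` are bounded by `Λ σ^{-θ}` and Lipschitz in the uniform distance of `u` and `v` with that
constant, and `∫ |f ∘ u|^p ≤ K`. -/
structure SmoothingBound (P : Measure V) (β p : ℝ) (f : ℝ → ℝ) (S : Set (V → ℝ)) (θ : ℝ)
    (Λ K : ℝ≥0) : Prop where
  measurable : Measurable f
  exponent_lt : θ < 1
  abs_avg_le : ∀ u ∈ S, ∀ σ ∈ Ioc (0 : ℝ) 1, ∀ x,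
    |avg P (σ ^ (1 / β)) (fun y => f (u y)) x| ≤ Λ * σ ^ (-θ)
  abs_avg_sub_le : ∀ u ∈ S, ∀ v ∈ S, ∀ δ : ℝ, 0 ≤ δ → (∀ᵐ y, |u y - v y| ≤ δ) →
    ∀ σ ∈ Ioc (0 : ℝ) 1, ∀ x, |avg P (σ ^ (1 / β)) (fun y => f (u y)) x -
      avg P (σ ^ (1 / β)) (fun y => f (v y)) x| ≤ δ * (Λ * σ ^ (-θ))
  lpInt_le : ∀ u ∈ S, lpInt p (fun y => f (u y)) ≤ K

lemma lintegral_exp_sub_smul_le_of_mem_expBall [IsProbabilityMeasure P] {c B : ℝ≥0}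
    (hP : P ≤ (c : ℝ≥0∞) • volume) {p q β κ σ : ℝ} (hκ : 0 ≤ κ) (hq : 1 ≤ q) (hβ : 0 < β)
    {u : V → ℝ} (hu : u ∈ expBall V p (κ * q) B) (hσ : σ ∈ Ioc (0 : ℝ) 1) (x : V) :
    ∫⁻ z, ENNReal.ofReal (Real.exp (κ * |u (x - σ ^ (1 / β) • z)| ^ p)) ∂P ≤
      ENNReal.ofReal ((1 + c * B) * σ ^ (-(finrank ℝ V / (β * q)))) := by
  have hscale : (σ ^ (1 / β)) ^ (-(finrank ℝ V / q)) = σ ^ (-(finrank ℝ V / (β * q))) := by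
    rw [← Real.rpow_mul hσ.1.le]
    congr 1
    field_simp
  have hconst : (1 + c * B : ℝ≥0∞) = ENNReal.ofReal (1 + c * B) := by
    exact_mod_cast (ENNReal.ofReal_coe_nnreal (p := 1 + c * B)).symm
  refine (lintegral_exp_sub_smul_le hP hκ hq (Real.rpow_pos_of_pos hσ.1 _)
    (Real.rpow_le_one hσ.1.le hσ.2 (by positivity)) hu.1 x).trans ?_
  rw [hscale, ENNReal.ofReal_mul (by positivity), ← hconst]
  gcongr
  exact hu.2

lemma exists_one_le_div_mul_lt_one (d : ℕ) {β : ℝ} (hβ : 0 < β) :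
    ∃ q : ℝ, 1 ≤ q ∧ d / (β * q) < 1 := by
  have h : 0 ≤ d / β := by positivity
  refine ⟨d / β + 1, by linarith, ?_⟩
  rw [div_lt_one (by positivity), mul_add, mul_div_cancel₀ _ hβ.ne']
  linarith

theorem ExpGrowth.exists_smoothingBound [IsProbabilityMeasure P] {p C lam β : ℝ} {f : ℝ → ℝ}
    {c : ℝ≥0} (hf : ExpGrowth p C lam f) (hP : P ≤ (c : ℝ≥0∞) • volume) (hβ : 0 < β) :
    ∃ μ θ : ℝ, 0 < μ ∧ ∀ B : ℝ≥0, ∃ Λ K : ℝ≥0,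
      SmoothingBound P β p f (expBall V p μ B) θ Λ K := by
  have hC := hf.const_pos
  have hl := hf.rate_pos
  obtain ⟨q, hq, hθ⟩ := exists_one_le_div_mul_lt_one (finrank ℝ V) hβ
  refine ⟨max (2 * lam * q) (lam * p + 1), finrank ℝ V / (β * q),
    lt_max_of_lt_left (by positivity), fun B => ?_⟩
  have hexp : ∀ u ∈ expBall V p (max (2 * lam * q) (lam * p + 1)) B, ∀ σ ∈ Ioc (0 : ℝ) 1, ∀ x,
      ∫⁻ z, ENNReal.ofReal (Real.exp (2 * lam * |u (x - σ ^ (1 / β) • z)| ^ p)) ∂P ≤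
        ENNReal.ofReal ((1 + c * B) * σ ^ (-(finrank ℝ V / (β * q)))) := fun u hu σ hσ x =>
    lintegral_exp_sub_smul_le_of_mem_expBall hP (by positivity) hq hβ
      ⟨hu.1, (expInt_mono (le_max_left _ _) u).trans hu.2⟩ hσ x
  have hnonneg : ∀ σ ∈ Ioc (0 : ℝ) 1, 0 ≤ (1 + c * B) * σ ^ (-(finrank ℝ V / (β * q))) :=
    fun σ hσ => mul_nonneg (by positivity) (Real.rpow_nonneg hσ.1.le _)
  have hΛ : 0 ≤ 2 * C * (1 + lam⁻¹) * (1 + c * B) := by positivity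
  refine ⟨.mk _ hΛ, ((2 * C) ^ p).toNNReal * B, hf.continuous.measurable, hθ, ?_, ?_, ?_⟩
  · intro u hu σ hσ x
    rw [NNReal.coe_mk, mul_assoc]
    exact hf.abs_integral_comp_le (hnonneg σ hσ) (hexp u hu σ hσ x)
  · intro u hu v hv δ hδ huv σ hσ x
    have hu1 := hu.1
    have hv1 := hv.1
    rw [NNReal.coe_mk, mul_assoc]
    exact hf.abs_integral_comp_sub_le (hnonneg σ hσ) (by fun_prop) (by fun_prop)
      (hexp u hu σ hσ x) (hexp v hv σ hσ x) hδ
      (ae_sub_smul hP huv (Real.rpow_pos_of_pos hσ.1 _).ne' x)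
  · intro u hu
    refine (hf.lpInt_comp_le u).trans ?_
    rw [ENNReal.coe_mul]
    exact mul_le_mul_right ((expInt_mono (le_max_right _ _) u).trans hu.2) _

end SmoothingBound

/-! ### The Duhamel map -/

lemma exists_fixedPoint_of_isSeqClosed {α : Type*} {A : Set (α → ℝ)} {Ψ : (α → ℝ) → α → ℝ}
    {M : ℝ} {K : ℝ≥0} (hK : K < 1) (hne : A.Nonempty) (hA : IsSeqClosed A)
    (hbdd : ∀ w ∈ A, ∀ a, |w a| ≤ M) (hΨ : MapsTo Ψ A A)
    (hlip : ∀ w ∈ A, ∀ v ∈ A, ∀ δ : ℝ, 0 ≤ δ → (∀ a, |w a - v a| ≤ δ) →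
      ∀ a, |Ψ w a - Ψ v a| ≤ K * δ) :
    ∃ w ∈ A, Ψ w = w := by
  let : TopologicalSpace α := ⊥
  have : DiscreteTopology α := ⟨rfl⟩
  let X : Set (α →ᵇ ℝ) := {w | ⇑w ∈ A}
  let toX (w : α → ℝ) (hw : w ∈ A) : X :=
    ⟨BoundedContinuousFunction.ofNormedAddCommGroupDiscrete w M (hbdd w hw), hw⟩
  have hX : IsClosed X := IsSeqClosed.isClosed fun w v hw hlim =>
    hA hw (BoundedContinuousFunction.continuous_coe.seqContinuous hlim)
  have : CompleteSpace X := hX.completeSpace_coe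
  have : Nonempty X := hne.elim fun w hw => ⟨toX w hw⟩
  have hΦ : ContractingWith K fun w : X => toX (Ψ w) (hΨ w.2) :=
    ⟨hK, LipschitzWith.of_dist_le_mul fun w v =>
      (BoundedContinuousFunction.dist_le (by positivity)).2 (hlip w w.2 v v.2 _ dist_nonneg
        (BoundedContinuousFunction.dist_coe_le_dist (f := w.1) (g := v.1)))⟩
  exact ⟨hΦ.fixedPoint, (hΦ.fixedPoint).2,
    congrArg (fun w : X => ⇑w.1) hΦ.fixedPoint_isFixedPt⟩

section TimeIntegral

variable {θ K T : ℝ} {F : ℝ → ℝ}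

lemma integrableOn_rpow_neg (hθ : θ < 1) (T : ℝ) :
    IntegrableOn (fun σ : ℝ => σ ^ (-θ)) (Ioc 0 T) :=
  (intervalIntegral.intervalIntegrable_rpow' (by linarith)).1

lemma setIntegral_rpow_neg (hθ : θ < 1) (hT : 0 ≤ T) :
    ∫ σ in Ioc 0 T, σ ^ (-θ) = T ^ (1 - θ) / (1 - θ) := by
  rw [← intervalIntegral.integral_of_le hT, integral_rpow (Or.inl (by linarith)),
    Real.zero_rpow (by linarith), sub_zero, neg_add_eq_sub]

lemma integrableOn_of_abs_le_rpow (hθ : θ < 1) (hF : Measurable F)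
    (hb : ∀ σ ∈ Ioc 0 T, |F σ| ≤ K * σ ^ (-θ)) : IntegrableOn F (Ioc 0 T) :=
  ((integrableOn_rpow_neg hθ T).const_mul K).mono' hF.aestronglyMeasurable
    (ae_restrict_of_forall_mem measurableSet_Ioc hb)

lemma abs_setIntegral_le_of_abs_le_rpow (hθ : θ < 1) (hT : 0 ≤ T)
    (hb : ∀ σ ∈ Ioc 0 T, |F σ| ≤ K * σ ^ (-θ)) :
    |∫ σ in Ioc 0 T, F σ| ≤ K * (T ^ (1 - θ) / (1 - θ)) := by
  rw [← setIntegral_rpow_neg hθ hT, ← integral_const_mul]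
  exact norm_integral_le_of_norm_le (f := F) ((integrableOn_rpow_neg hθ T).const_mul K)
    (ae_restrict_of_forall_mem measurableSet_Ioc hb)

lemma intervalIntegral_comp_sub_left_eq_setIntegral (hT : 0 ≤ T) (F : ℝ → ℝ) :
    ∫ s in (0 : ℝ)..T, F (T - s) = ∫ σ in Ioc 0 T, F σ := by
  rw [intervalIntegral.integral_comp_sub_left F T, sub_self, sub_zero,
    intervalIntegral.integral_of_le hT]

lemma intervalIntegrable_comp_sub_left (hT : 0 ≤ T)
    (hF : IntegrableOn F (Ioc 0 T)) : IntervalIntegrable (fun s => F (T - s)) volume 0 T := by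
  simpa using
    (((intervalIntegrable_iff_integrableOn_Ioc_of_le hT).2 hF).comp_sub_left T).symm

end TimeIntegral

section Source

variable {V : Type*} {f : ℝ → ℝ} {T : ℝ} {a w : ℝ × V → ℝ}

/-- The source term `f (a + w)`, cut off outside the time interval `(0, T]`, so that the Duhamel
integral at every time is an integral over all of `(0, T]`. -/
def source (f : ℝ → ℝ) (T : ℝ) (a w : ℝ × V → ℝ) (s : ℝ) (y : V) : ℝ :=
  if s ∈ Ioc 0 T then f (a (s, y) + w (s, y)) else 0

lemma source_of_mem {s : ℝ} (hs : s ∈ Ioc 0 T) :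
    source f T a w s = fun y => f (a (s, y) + w (s, y)) :=
  funext fun _ => if_pos hs

lemma source_of_notMem {s : ℝ} (hs : s ∉ Ioc 0 T) : source f T a w s = fun _ => 0 :=
  funext fun _ => if_neg hs

lemma measurable_source [MeasurableSpace V] (hf : Measurable f) (ha : Measurable a)
    (hw : Measurable w) : Measurable (Function.uncurry (source f T a w)) :=
  (hf.comp (ha.add hw)).ite (measurable_fst measurableSet_Ioc) measurable_const

end Source

section Duhamel

variable {V : Type*} [NormedAddCommGroup V] [InnerProductSpace ℝ V] [FiniteDimensional ℝ V]
  [MeasurableSpace V] [BorelSpace V] {P : Measure V} {β p T θ : ℝ} {f : ℝ → ℝ}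
  {S : Set (V → ℝ)} {Λ K : ℝ≥0} {a w v : ℝ × V → ℝ}

lemma lpInt_uncurry {α Ω : Type*} [MeasurableSpace α] [MeasurableSpace Ω] {ν : Measure α}
    {ν' : Measure Ω} [SFinite ν'] {g : α → Ω → ℝ} (hg : Measurable (Function.uncurry g)) :
    lpInt p (Function.uncurry g) (ν.prod ν') = ∫⁻ s, lpInt p (g s) ν' ∂ν :=
  lintegral_prod _ (hg.enorm.pow_const p).aemeasurable

lemma lpInt_avg_le [IsProbabilityMeasure P] (hp : 1 ≤ p) {u : V → ℝ} (hu : Measurable u) (r : ℝ) :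
    lpInt p (avg P r u) ≤ lpInt p u :=
  (lpInt_integral_le (by simp) hp (by unfold Function.uncurry; fun_prop)).trans_eq
    (by simp only [lpInt, lintegral_sub_right_eq_self (fun x => ‖u x‖ₑ ^ p), lintegral_const,
      measure_univ, mul_one])

lemma lpInt_setIntegral_avg_le [IsProbabilityMeasure P] (hp : 1 ≤ p) (hT : T ≤ 1)
    {H : ℝ → V → ℝ} (hH : Measurable (Function.uncurry H)) :
    lpInt p (fun x => ∫ σ in Ioc 0 T, avg P (σ ^ (1 / β)) (H σ) x) ≤
      ∫⁻ σ in Ioc 0 T, lpInt p (H σ) :=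
  (lpInt_integral_le (by simpa using hT) hp
    (measurable_avg (g := fun y : V × ℝ => H y.2)
      (hH.comp (by fun_prop : Measurable fun y : (V × ℝ) × V => (y.1.2, y.2)))
      (by fun_prop) measurable_fst)).trans
    (lintegral_mono fun σ => lpInt_avg_le hp hH.of_uncurry_left _)

/-- The perturbations `w` among which the solution `S(t) u₀ + w(t)` is sought. -/
structure Admissible (p : ℝ) (w : ℝ × V → ℝ) : Prop where
  measurable : Measurable w
  abs_le_one : ∀ y, |w y| ≤ 1
  lpInt_le_one : ∀ t, lpInt p (fun x => w (t, x)) ≤ 1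

lemma isSeqClosed_admissible : IsSeqClosed {w : ℝ × V → ℝ | Admissible p w} := by
  intro w v hw hlim
  have hpt := tendsto_pi_nhds.1 hlim
  refine ⟨measurable_of_tendsto_metrizable (fun k => (hw k).measurable) hlim,
    fun y => le_of_tendsto' (hpt y).abs fun k => (hw k).abs_le_one y, fun t => ?_⟩
  have hliminf : ∀ x, liminf (fun k => ‖w k (t, x)‖ₑ ^ p) atTop = ‖v (t, x)‖ₑ ^ p := fun x =>
    (((ENNReal.continuous_rpow_const (y := p)).tendsto _).comp
      ((continuous_enorm.tendsto _).comp (hpt (t, x)))).liminf_eq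
  simp only [lpInt, ← hliminf]
  exact (lintegral_liminf_le fun k =>
    ((hw k).measurable.comp measurable_prodMk_left).enorm.pow_const p).trans
    (liminf_le_of_frequently_le' (Frequently.of_forall fun k => (hw k).lpInt_le_one t))

lemma admissible_zero (hp : 0 < p) : Admissible p (fun _ : ℝ × V => 0) :=
  ⟨measurable_const, by simp, by simp [lpInt, hp]⟩

/-- The Duhamel integral `∫ S(σ) f(a + w)(t - σ) dσ`, at `(t, x)`. -/
def duhamelMap (P : Measure V) (β : ℝ) (f : ℝ → ℝ) (T : ℝ) (a w : ℝ × V → ℝ) (y : ℝ × V) : ℝ :=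
  ∫ σ in Ioc 0 T, avg P (σ ^ (1 / β)) (source f T a w (y.1 - σ)) y.2

/-- The conditions under which `w ↦ duhamelMap P β f T a w` is a contraction of the admissible
functions. -/
structure PicardData (P : Measure V) (β p : ℝ) (f : ℝ → ℝ) (S : Set (V → ℝ)) (θ : ℝ)
    (Λ K : ℝ≥0) (T : ℝ) (a : ℝ × V → ℝ) : Prop where
  bound : SmoothingBound P β p f S θ Λ K
  measurable : Measurable a
  add_mem : ∀ w, Admissible p w → ∀ s, (fun y => a (s, y) + w (s, y)) ∈ S
  time_pos : 0 < T
  time_le_one : T ≤ 1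
  sup_small : Λ * (T ^ (1 - θ) / (1 - θ)) ≤ 1 / 2
  lpInt_small : T * K ≤ 1

lemma measurable_avg_source [SFinite P] (hg : Measurable (Function.uncurry (source f T a w))) :
    Measurable fun q : (ℝ × V) × ℝ =>
      avg P (q.2 ^ (1 / β)) (source f T a w (q.1.1 - q.2)) q.1.2 :=
  measurable_avg (g := fun q : (ℝ × V) × ℝ => source f T a w (q.1.1 - q.2))
    (hg.comp (by fun_prop : Measurable fun q : ((ℝ × V) × ℝ) × V => (q.1.1.1 - q.1.2, q.2)))
    (by fun_prop) (by fun_prop)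

namespace PicardData

lemma measurable_source (D : PicardData P β p f S θ Λ K T a) (hw : Admissible p w) :
    Measurable (Function.uncurry (source f T a w)) :=
  FracHeat.measurable_source D.bound.measurable D.measurable hw.measurable

lemma abs_avg_source_le (D : PicardData P β p f S θ Λ K T a) (hw : Admissible p w) (s : ℝ)
    {σ : ℝ} (hσ : σ ∈ Ioc 0 T) (x : V) :
    |avg P (σ ^ (1 / β)) (source f T a w s) x| ≤ Λ * σ ^ (-θ) := by
  by_cases hs : s ∈ Ioc 0 T
  · rw [source_of_mem hs]
    exact D.bound.abs_avg_le _ (D.add_mem w hw s) σ (Ioc_subset_Ioc_right D.time_le_one hσ) x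
  · have := hσ.1
    simpa only [source_of_notMem hs, avg, integral_zero, abs_zero] using by positivity

lemma abs_avg_source_sub_le (D : PicardData P β p f S θ Λ K T a) (hw : Admissible p w)
    (hv : Admissible p v) {δ : ℝ} (hδ : 0 ≤ δ) (hwv : ∀ y, |w y - v y| ≤ δ) (s : ℝ) {σ : ℝ}
    (hσ : σ ∈ Ioc 0 T) (x : V) :
    |avg P (σ ^ (1 / β)) (source f T a w s) x - avg P (σ ^ (1 / β)) (source f T a v s) x| ≤
      δ * (Λ * σ ^ (-θ)) := by
  by_cases hs : s ∈ Ioc 0 T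
  · rw [source_of_mem hs, source_of_mem hs]
    exact D.bound.abs_avg_sub_le _ (D.add_mem w hw s) _ (D.add_mem v hv s) δ hδ
      (.of_forall fun y => by simpa only [add_sub_add_left_eq_sub] using hwv (s, y)) σ
      (Ioc_subset_Ioc_right D.time_le_one hσ) x
  · have := hσ.1
    simpa only [source_of_notMem hs, avg, integral_zero, sub_self, abs_zero] using by positivity

lemma lpInt_source_le (D : PicardData P β p f S θ Λ K T a) (hp : 0 < p) (hw : Admissible p w)
    (s : ℝ) : lpInt p (source f T a w s) ≤ (Ioc 0 T).indicator (fun _ => (K : ℝ≥0∞)) s := by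
  by_cases hs : s ∈ Ioc 0 T
  · rw [source_of_mem hs, indicator_of_mem hs]
    exact D.bound.lpInt_le _ (D.add_mem w hw s)
  · simp [source_of_notMem hs, lpInt, hp]

lemma lpInt_source_ne_top (D : PicardData P β p f S θ Λ K T a) (hp : 0 < p)
    (hw : Admissible p w) (s : ℝ) : lpInt p (source f T a w s) ≠ ⊤ :=
  ne_top_of_le_ne_top ENNReal.coe_ne_top
    ((D.lpInt_source_le hp hw s).trans (indicator_le_self _ _ _))

lemma integrableOn_avg_source [SFinite P] (D : PicardData P β p f S θ Λ K T a)
    (hw : Admissible p w) (t : ℝ) (x : V) :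
    IntegrableOn (fun σ => avg P (σ ^ (1 / β)) (source f T a w (t - σ)) x) (Ioc 0 T) :=
  integrableOn_of_abs_le_rpow D.bound.exponent_lt
    ((measurable_avg_source (D.measurable_source hw)).comp
      (measurable_prodMk_left (x := (t, x)))) fun _ hσ => D.abs_avg_source_le hw _ hσ x

lemma lpInt_duhamelMap_le_one [IsProbabilityMeasure P] (D : PicardData P β p f S θ Λ K T a)
    (hp : 1 ≤ p) (hw : Admissible p w) (t : ℝ) :
    lpInt p (fun x => duhamelMap P β f T a w (t, x)) ≤ 1 :=
  calc _ ≤ ∫⁻ σ in Ioc 0 T, lpInt p (source f T a w (t - σ)) :=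
        lpInt_setIntegral_avg_le hp D.time_le_one (H := fun σ => source f T a w (t - σ))
          ((D.measurable_source hw).comp
            (by fun_prop : Measurable fun y : ℝ × V => (t - y.1, y.2)))
    _ ≤ ∫⁻ _ in Ioc 0 T, (K : ℝ≥0∞) := lintegral_mono fun σ =>
        (D.lpInt_source_le (by linarith) hw (t - σ)).trans (indicator_le_self _ _ _)
    _ = ENNReal.ofReal (T * K) := by
        rw [lintegral_const, Measure.restrict_apply_univ, Real.volume_Ioc, sub_zero, mul_comm,
          ENNReal.ofReal_mul D.time_pos.le, ENNReal.ofReal_coe_nnreal]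
    _ ≤ 1 := ENNReal.ofReal_le_one.2 D.lpInt_small

lemma admissible_duhamelMap [IsProbabilityMeasure P] (D : PicardData P β p f S θ Λ K T a)
    (hp : 1 ≤ p) (hw : Admissible p w) : Admissible p (duhamelMap P β f T a w) where
  measurable := ((measurable_avg_source
    (D.measurable_source hw)).stronglyMeasurable.integral_prod_right'
      (ν := volume.restrict (Ioc 0 T))).measurable
  abs_le_one y := (abs_setIntegral_le_of_abs_le_rpow D.bound.exponent_lt D.time_pos.le fun _ hσ =>
    D.abs_avg_source_le hw _ hσ y.2).trans (D.sup_small.trans (by norm_num))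
  lpInt_le_one := D.lpInt_duhamelMap_le_one hp hw

lemma abs_duhamelMap_sub_le [SFinite P] (D : PicardData P β p f S θ Λ K T a)
    (hw : Admissible p w) (hv : Admissible p v) {δ : ℝ} (hδ : 0 ≤ δ)
    (hwv : ∀ y, |w y - v y| ≤ δ) (y : ℝ × V) :
    |duhamelMap P β f T a w y - duhamelMap P β f T a v y| ≤ 1 / 2 * δ := by
  rw [duhamelMap, duhamelMap, ← integral_sub (D.integrableOn_avg_source hw y.1 y.2)
    (D.integrableOn_avg_source hv y.1 y.2)]
  calc _ ≤ δ * Λ * (T ^ (1 - θ) / (1 - θ)) :=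
        abs_setIntegral_le_of_abs_le_rpow D.bound.exponent_lt D.time_pos.le fun _ hσ =>
          (D.abs_avg_source_sub_le hw hv hδ hwv _ hσ y.2).trans_eq (mul_assoc _ _ _).symm
    _ = Λ * (T ^ (1 - θ) / (1 - θ)) * δ := by ring
    _ ≤ 1 / 2 * δ := mul_le_mul_of_nonneg_right D.sup_small hδ

theorem exists_fixedPoint [IsProbabilityMeasure P] (D : PicardData P β p f S θ Λ K T a)
    (hp : 1 ≤ p) : ∃ w, Admissible p w ∧ duhamelMap P β f T a w = w :=
  exists_fixedPoint_of_isSeqClosed (A := {w | Admissible p w}) (K := 1 / 2) (M := 1)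
    (by norm_num) ⟨_, admissible_zero (by linarith)⟩ isSeqClosed_admissible
    (fun _ hw => hw.abs_le_one) (fun _ hw => D.admissible_duhamelMap hp hw)
    fun w hw v hv δ hδ hwv y => by
      simpa using D.abs_duhamelMap_sub_le hw hv hδ hwv y

lemma memLp_source (D : PicardData P β p f S θ Λ K T a) (hp : 0 < p) (hw : Admissible p w) :
    MemLp (Function.uncurry (source f T a w)) (ENNReal.ofReal p) := by
  have hm := D.measurable_source hw
  rw [memLp_iff_lpInt_ne_top hp hm.aestronglyMeasurable, Measure.volume_eq_prod, lpInt_uncurry hm]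
  refine ne_top_of_le_ne_top ?_ (lintegral_mono fun s => D.lpInt_source_le hp hw s)
  rw [lintegral_indicator_const measurableSet_Ioc, Real.volume_Ioc]
  finiteness

lemma duhamelMap_sub_eq [IsProbabilityMeasure P] {c : ℝ≥0}
    (D : PicardData P β p f S θ Λ K T a) (hP : P ≤ (c : ℝ≥0∞) • volume) (hp : 1 ≤ p)
    (hw : Admissible p w) (t t₀ : ℝ) (x : V) :
    duhamelMap P β f T a w (t, x) - duhamelMap P β f T a w (t₀, x) =
      ∫ σ in Ioc 0 T, avg P (σ ^ (1 / β))
        (fun y => source f T a w (t - σ) y - source f T a w (t₀ - σ) y) x := by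
  have hint (s r : ℝ) : Integrable (fun z => source f T a w s (x - r • z)) P :=
    integrable_sub_smul_of_lpInt hP hp (D.measurable_source hw).of_uncurry_left
      (D.lpInt_source_ne_top (by linarith) hw s) r x
  rw [duhamelMap, duhamelMap, ← integral_sub (D.integrableOn_avg_source hw t x)
    (D.integrableOn_avg_source hw t₀ x)]
  exact integral_congr_ae (.of_forall fun σ => (integral_sub (hint _ _) (hint _ _)).symm)

lemma lpInt_duhamelMap_sub_le [IsProbabilityMeasure P] {c : ℝ≥0}
    (D : PicardData P β p f S θ Λ K T a) (hP : P ≤ (c : ℝ≥0∞) • volume) (hp : 1 ≤ p)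
    (hw : Admissible p w) (t t₀ : ℝ) :
    lpInt p (fun x => duhamelMap P β f T a w (t, x) - duhamelMap P β f T a w (t₀, x)) ≤
      lpInt p fun y => Function.uncurry (source f T a w) (y + (t - t₀, 0)) -
        Function.uncurry (source f T a w) y := by
  let g := source f T a w
  have hg : Measurable (Function.uncurry g) := D.measurable_source hw
  have hsub (b d : ℝ → ℝ) (hb : Measurable b) (hd : Measurable d) :
      Measurable (Function.uncurry fun s y => g (b s) y - g (d s) y) :=
    (hg.comp (by fun_prop : Measurable fun y : ℝ × V => (b y.1, y.2))).sub
      (hg.comp (by fun_prop : Measurable fun y : ℝ × V => (d y.1, y.2)))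
  calc _ = lpInt p (fun x => ∫ σ in Ioc 0 T, avg P (σ ^ (1 / β))
          (fun y => g (t - σ) y - g (t₀ - σ) y) x) := by
        simp only [D.duhamelMap_sub_eq hP hp hw t t₀, g]
    _ ≤ ∫⁻ σ in Ioc 0 T, lpInt p (fun y => g (t - σ) y - g (t₀ - σ) y) :=
        lpInt_setIntegral_avg_le hp D.time_le_one
          (hsub (t - ·) (t₀ - ·) (by fun_prop) (by fun_prop))
    _ ≤ ∫⁻ σ, lpInt p (fun y => g (t - σ) y - g (t₀ - σ) y) := setLIntegral_le_lintegral _ _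
    _ = ∫⁻ s, lpInt p (fun y => g (s + (t - t₀)) y - g s y) := by
        have hreflect (s : ℝ) : t₀ - s + (t - t₀) = t - s := by ring
        refine Eq.trans ?_ (lintegral_sub_left_eq_self
          (fun s => lpInt p fun y => g (s + (t - t₀)) y - g s y) t₀)
        simp only [hreflect]
    _ = lpInt p (Function.uncurry fun s y => g (s + (t - t₀)) y - g s y) := by
        rw [Measure.volume_eq_prod]
        exact (lpInt_uncurry (hsub (· + (t - t₀)) id (by fun_prop) measurable_id)).symm
    _ = _ := by simp [Function.uncurry_def, g]

lemma tendsto_lpInt_duhamelMap_sub [IsProbabilityMeasure P] {c : ℝ≥0}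
    (D : PicardData P β p f S θ Λ K T a) (hP : P ≤ (c : ℝ≥0∞) • volume) (hp : 1 ≤ p)
    (hw : Admissible p w) (t₀ : ℝ) :
    Tendsto (fun t => lpInt p
      (fun x => duhamelMap P β f T a w (t, x) - duhamelMap P β f T a w (t₀, x)))
      (𝓝 t₀) (𝓝 0) := by
  have : (volume : Measure (ℝ × V)).IsAddHaarMeasure := by
    rw [Measure.volume_eq_prod]
    infer_instance
  have hshift : Tendsto (fun t : ℝ => ((t - t₀, 0) : ℝ × V)) (𝓝 t₀) (𝓝 0) :=
    Continuous.tendsto' (by fun_prop) _ _ (by simp)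
  exact tendsto_of_tendsto_of_tendsto_of_le_of_le tendsto_const_nhds
    ((tendsto_lpInt_translate_sub volume hp (D.memLp_source (by linarith) hw)).comp hshift)
    (fun _ => zero_le) fun t => D.lpInt_duhamelMap_sub_le hP hp hw t t₀

end PicardData

end Duhamel

/-! ### Uniqueness -/

/-- The exponentially weighted integral `∫₀¹ exp (-γ σ) σ^{-θ} dσ`, the Lipschitz constant of the
Duhamel map in the norm `sup_t exp (-γ t) ‖w(t)‖_∞`, up to a factor. -/
def weightedSingular (θ γ : ℝ) : ℝ := ∫ σ in Ioc (0 : ℝ) 1, Real.exp (-γ * σ) * σ ^ (-θ)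

section WeightedSingular

variable {θ γ : ℝ}

lemma exp_neg_mul_rpow_nonneg {σ : ℝ} (hσ : 0 ≤ σ) : 0 ≤ Real.exp (-γ * σ) * σ ^ (-θ) :=
  mul_nonneg (Real.exp_pos _).le (Real.rpow_nonneg hσ _)

lemma exp_neg_mul_rpow_le (hγ : 0 ≤ γ) {σ : ℝ} (hσ : 0 ≤ σ) :
    Real.exp (-γ * σ) * σ ^ (-θ) ≤ σ ^ (-θ) :=
  mul_le_of_le_one_left (Real.rpow_nonneg hσ _)
    (Real.exp_le_one_iff.2 (mul_nonpos_of_nonpos_of_nonneg (neg_nonpos.2 hγ) hσ))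

lemma integrableOn_exp_neg_mul_rpow (hθ : θ < 1) (hγ : 0 ≤ γ) :
    IntegrableOn (fun σ : ℝ => Real.exp (-γ * σ) * σ ^ (-θ)) (Ioc 0 1) :=
  integrableOn_of_abs_le_rpow (K := 1) hθ (by fun_prop) fun σ hσ => by
    rw [abs_of_nonneg (exp_neg_mul_rpow_nonneg hσ.1.le), one_mul]
    exact exp_neg_mul_rpow_le hγ hσ.1.le

lemma weightedSingular_nonneg : 0 ≤ weightedSingular θ γ :=
  setIntegral_nonneg measurableSet_Ioc fun _ hσ => exp_neg_mul_rpow_nonneg hσ.1.le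

lemma tendsto_weightedSingular (hθ : θ < 1) :
    Tendsto (weightedSingular θ) atTop (𝓝 0) := by
  have hlim : Tendsto (weightedSingular θ) atTop (𝓝 (∫ _ in Ioc (0 : ℝ) 1, (0 : ℝ))) := by
    refine tendsto_integral_filter_of_dominated_convergence (fun σ => σ ^ (-θ))
      (.of_forall fun γ => by fun_prop)
      ((eventually_ge_atTop 0).mono fun γ hγ => ae_restrict_of_forall_mem measurableSet_Ioc
        fun σ hσ => ?_) (integrableOn_rpow_neg hθ 1)
      (ae_restrict_of_forall_mem measurableSet_Ioc fun σ hσ => ?_)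
    · rw [Real.norm_eq_abs, abs_of_nonneg (exp_neg_mul_rpow_nonneg hσ.1.le)]
      exact exp_neg_mul_rpow_le hγ hσ.1.le
    · have : Tendsto (fun γ : ℝ => -γ * σ) atTop atBot :=
        tendsto_neg_atTop_atBot.atBot_mul_const hσ.1
      simpa using (Real.tendsto_exp_atBot.comp this).mul_const (σ ^ (-θ))
  simpa using hlim

lemma setIntegral_le_weightedSingular (hθ : θ < 1) (hγ : 0 ≤ γ) {t : ℝ} (ht1 : t ≤ 1) :
    ∫ σ in Ioc 0 t, Real.exp (-γ * σ) * σ ^ (-θ) ≤ weightedSingular θ γ :=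
  setIntegral_mono_set (integrableOn_exp_neg_mul_rpow hθ hγ)
    (ae_restrict_of_forall_mem measurableSet_Ioc fun _ hσ => exp_neg_mul_rpow_nonneg hσ.1.le)
    (Ioc_subset_Ioc_right ht1).eventuallyLE

lemma abs_intervalIntegral_le_weightedSingular {K t : ℝ} (hθ : θ < 1) (hγ : 0 ≤ γ)
    (hK : 0 ≤ K) (ht : 0 ≤ t) (ht1 : t ≤ 1) {F : ℝ → ℝ}
    (hF : ∀ s ∈ Ioo 0 t, |F s| ≤ K * Real.exp (γ * s) * (t - s) ^ (-θ)) :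
    |∫ s in (0 : ℝ)..t, F s| ≤ K * weightedSingular θ γ * Real.exp (γ * t) := by
  let G (σ : ℝ) : ℝ := K * Real.exp (γ * t) * (Real.exp (-γ * σ) * σ ^ (-θ))
  have hG : IntegrableOn G (Ioc 0 t) :=
    ((integrableOn_exp_neg_mul_rpow hθ hγ).mono_set (Ioc_subset_Ioc_right ht1)).const_mul _
  have hFG : ∀ s ∈ Ioo 0 t, |F s| ≤ G (t - s) := fun s hs => by
    refine (hF s hs).trans_eq ?_
    have : Real.exp (γ * s) = Real.exp (γ * t) * Real.exp (-γ * (t - s)) := by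
      rw [← Real.exp_add]
      ring_nf
    simp only [G, this, mul_assoc]
  calc |∫ s in (0 : ℝ)..t, F s| ≤ ∫ s in (0 : ℝ)..t, G (t - s) :=
        intervalIntegral.norm_integral_le_of_norm_le (f := F) ht
          ((Measure.ae_ne volume t).mono fun s hst hs => hFG s ⟨hs.1, hs.2.lt_of_ne hst⟩)
          (intervalIntegrable_comp_sub_left ht hG)
    _ = K * Real.exp (γ * t) * ∫ σ in Ioc 0 t, Real.exp (-γ * σ) * σ ^ (-θ) := by
        rw [intervalIntegral_comp_sub_left_eq_setIntegral ht, integral_const_mul]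
    _ ≤ K * Real.exp (γ * t) * weightedSingular θ γ := by
        gcongr
        exact setIntegral_le_weightedSingular hθ hγ ht1
    _ = K * weightedSingular θ γ * Real.exp (γ * t) := by ring

end WeightedSingular

section Uniqueness

variable {n : ℕ} {p β T μ : ℝ} {f : ℝ → ℝ} {u₀ : Fn n} {u v : ℝ → Fn n}

lemma IsContinuousCurve.eventually_expInt_le (hp : 0 < p) (hu : IsContinuousCurve p T u)
    (hμ : 0 < μ) {t₀ : ℝ} (ht₀ : t₀ ∈ Icc 0 T) :
    ∃ B : ℝ≥0, ∀ᶠ t in 𝓝[Icc 0 T] t₀, expInt p μ (u t) ≤ B := by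
  have hμ' : 0 < μ * 2 ^ p := by positivity
  lift expInt p (μ * 2 ^ p) (u t₀) to ℝ≥0 using
    isHeart_of_mem_expLZero hp (hu.mem t₀ ht₀) _ hμ' with B hB
  refine ⟨1 + B, ((tendsto_luxNorm_zero_iff hp).1 (hu.cont t₀ ht₀) _ hμ').mono fun t ht => ?_⟩
  calc expInt p μ (u t) = expInt p μ (fun x => (u t x - u t₀ x) + u t₀ x) := by
        simp only [sub_add_cancel]
    _ ≤ expInt p (μ * 2 ^ p) (fun x => u t x - u t₀ x) + expInt p (μ * 2 ^ p) (u t₀) :=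
        expInt_add_le hp.le hμ.le ((u t).measurable.sub (u t₀).measurable) _
    _ ≤ ((1 + B : ℝ≥0) : ℝ≥0∞) := by
        rw [ENNReal.coe_add, ENNReal.coe_one, hB]
        gcongr

lemma IsContinuousCurve.exists_mem_expBall (hp : 0 < p) (hu : IsContinuousCurve p T u)
    (hμ : 0 < μ) : ∃ B : ℝ≥0, ∀ t ∈ Icc 0 T, ⇑(u t) ∈ expBall (E n) p μ B := by
  refine isCompact_Icc.induction_on
    (p := fun s => ∃ B : ℝ≥0, ∀ t ∈ s, ⇑(u t) ∈ expBall (E n) p μ B)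
    ⟨0, fun t ht => ht.elim⟩ ?_ ?_ ?_
  · rintro s s' hss ⟨B, hB⟩
    exact ⟨B, fun t ht => hB t (hss ht)⟩
  · rintro s s' ⟨B, hB⟩ ⟨B', hB'⟩
    exact ⟨max B B', fun t ht => ht.elim (fun h => expBall_mono (le_max_left _ _) (hB t h))
      fun h => expBall_mono (le_max_right _ _) (hB' t h)⟩
  · intro t₀ ht₀
    obtain ⟨B, hB⟩ := hu.eventually_expInt_le hp hμ ht₀
    exact ⟨_, hB, B, fun t ht => ⟨(u t).measurable, ht⟩⟩

namespace IsMildSolution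

variable {θ γ M : ℝ} {S : Set (E n → ℝ)} {Λ K : ℝ≥0}

lemma ae_abs_sub_le {A : ℝ} (hβ0 : 0 < β) (hβ2 : β ≤ 2) (hT : T ≤ 1)
    (hu : IsMildSolution p β f u₀ T u) (hv : IsMildSolution p β f u₀ T v) (hθ : θ < 1)
    (hγ : 0 ≤ γ) (hA : 0 ≤ A) {t : ℝ} (ht : t ∈ Icc 0 T)
    (h : ∀ s ∈ Ioo 0 t, ∀ x, |avg (stableLaw n β) ((t - s) ^ (1 / β)) (fun y => f (u s y)) x -
      avg (stableLaw n β) ((t - s) ^ (1 / β)) (fun y => f (v s y)) x| ≤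
        A * Real.exp (γ * s) * (t - s) ^ (-θ)) :
    ∀ᵐ x, |u t x - v t x| ≤ A * weightedSingular θ γ * Real.exp (γ * t) := by
  filter_upwards [hu.duhamel t ht, hv.duhamel t ht] with x hux hvx
  rw [hux.2, hvx.2, add_sub_add_left_eq_sub, ← intervalIntegral.integral_sub hux.1 hvx.1]
  refine abs_intervalIntegral_le_weightedSingular hθ hγ hA ht.1 (ht.2.trans hT) fun s hs => ?_
  have hts : 0 ≤ t - s := sub_nonneg.2 hs.2.le
  rw [semigroup_eq_avg hβ0 hβ2 hts, semigroup_eq_avg hβ0 hβ2 hts]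
  exact h s hs x

lemma ae_abs_sub_le_const (hβ0 : 0 < β) (hβ2 : β ≤ 2) (hT : T ≤ 1)
    (hu : IsMildSolution p β f u₀ T u) (hv : IsMildSolution p β f u₀ T v)
    (hS : SmoothingBound (stableLaw n β) β p f S θ Λ K) (huS : ∀ t ∈ Icc 0 T, ⇑(u t) ∈ S)
    (hvS : ∀ t ∈ Icc 0 T, ⇑(v t) ∈ S) {t : ℝ} (ht : t ∈ Icc 0 T) :
    ∀ᵐ x, |u t x - v t x| ≤ 2 * Λ * weightedSingular θ 0 := by
  have h := ae_abs_sub_le hβ0 hβ2 hT hu hv hS.exponent_lt le_rfl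
    (A := 2 * Λ) (by positivity) ht fun s hs x => by
      have hsT : s ∈ Icc 0 T := ⟨hs.1.le, hs.2.le.trans ht.2⟩
      have hts : t - s ∈ Ioc 0 1 := ⟨sub_pos.2 hs.2, by linarith [hs.1, ht.2]⟩
      calc _ ≤ Λ * (t - s) ^ (-θ) + Λ * (t - s) ^ (-θ) := (abs_sub _ _).trans (add_le_add
            (hS.abs_avg_le _ (huS s hsT) _ hts x) (hS.abs_avg_le _ (hvS s hsT) _ hts x))
        _ = 2 * Λ * Real.exp (0 * s) * (t - s) ^ (-θ) := by
            rw [zero_mul, Real.exp_zero]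
            ring
  simpa only [zero_mul, Real.exp_zero, mul_one] using h

lemma ae_abs_sub_le_mul (hβ0 : 0 < β) (hβ2 : β ≤ 2) (hT : T ≤ 1)
    (hu : IsMildSolution p β f u₀ T u) (hv : IsMildSolution p β f u₀ T v)
    (hS : SmoothingBound (stableLaw n β) β p f S θ Λ K) (huS : ∀ t ∈ Icc 0 T, ⇑(u t) ∈ S)
    (hvS : ∀ t ∈ Icc 0 T, ⇑(v t) ∈ S) (hγ : 0 ≤ γ) (hM : 0 ≤ M)
    (h : ∀ s ∈ Icc 0 T, ∀ᵐ x, |u s x - v s x| ≤ M * Real.exp (γ * s)) {t : ℝ}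
    (ht : t ∈ Icc 0 T) :
    ∀ᵐ x, |u t x - v t x| ≤ M * Λ * weightedSingular θ γ * Real.exp (γ * t) :=
  ae_abs_sub_le hβ0 hβ2 hT hu hv hS.exponent_lt hγ (by positivity) ht fun s hs x => by
    have hsT : s ∈ Icc 0 T := ⟨hs.1.le, hs.2.le.trans ht.2⟩
    calc _ ≤ M * Real.exp (γ * s) * (Λ * (t - s) ^ (-θ)) :=
          hS.abs_avg_sub_le _ (huS s hsT) _ (hvS s hsT) _ (by positivity) (h s hsT) _
            ⟨sub_pos.2 hs.2, by linarith [hs.1, ht.2]⟩ x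
      _ = M * Λ * Real.exp (γ * s) * (t - s) ^ (-θ) := by ring

lemma exists_ae_abs_sub_le_geometric (hβ0 : 0 < β) (hβ2 : β ≤ 2) (hT : T ≤ 1)
    (hu : IsMildSolution p β f u₀ T u) (hv : IsMildSolution p β f u₀ T v)
    (hS : SmoothingBound (stableLaw n β) β p f S θ Λ K) (huS : ∀ t ∈ Icc 0 T, ⇑(u t) ∈ S)
    (hvS : ∀ t ∈ Icc 0 T, ⇑(v t) ∈ S) :
    ∃ M γ : ℝ, ∀ k : ℕ, ∀ t ∈ Icc 0 T,
      ∀ᵐ x, |u t x - v t x| ≤ M * (1 / 2) ^ k * Real.exp (γ * t) := by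
  obtain ⟨γ, hγ, hγ0⟩ : ∃ γ, Λ * weightedSingular θ γ ≤ 1 / 2 ∧ 0 ≤ γ := by
    have h := (tendsto_weightedSingular hS.exponent_lt).const_mul (Λ : ℝ)
    rw [mul_zero] at h
    exact ((h.eventually_le_const (by norm_num)).and (eventually_ge_atTop 0)).exists
  have hM : 0 ≤ 2 * Λ * weightedSingular θ 0 :=
    mul_nonneg (by positivity) weightedSingular_nonneg
  refine ⟨2 * Λ * weightedSingular θ 0, γ, fun k => ?_⟩
  induction k with
  | zero =>
    intro t ht
    filter_upwards [ae_abs_sub_le_const hβ0 hβ2 hT hu hv hS huS hvS ht] with x hx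
    rw [pow_zero, mul_one]
    exact hx.trans (le_mul_of_one_le_right hM (Real.one_le_exp (mul_nonneg hγ0 ht.1)))
  | succ k ih =>
    intro t ht
    filter_upwards [ae_abs_sub_le_mul hβ0 hβ2 hT hu hv hS huS hvS hγ0 (by positivity) ih ht]
      with x hx
    rw [pow_succ, ← mul_assoc]
    refine hx.trans (mul_le_mul_of_nonneg_right ?_ (Real.exp_pos _).le)
    rw [mul_assoc _ (Λ : ℝ)]
    exact mul_le_mul_of_nonneg_left hγ (by positivity)

lemma eq_of_mem_smoothingBound (hβ0 : 0 < β) (hβ2 : β ≤ 2) (hT : T ≤ 1)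
    (hu : IsMildSolution p β f u₀ T u) (hv : IsMildSolution p β f u₀ T v)
    (hS : SmoothingBound (stableLaw n β) β p f S θ Λ K) (huS : ∀ t ∈ Icc 0 T, ⇑(u t) ∈ S)
    (hvS : ∀ t ∈ Icc 0 T, ⇑(v t) ∈ S) {t : ℝ} (ht : t ∈ Icc 0 T) : u t = v t := by
  obtain ⟨M, γ, h⟩ := exists_ae_abs_sub_le_geometric hβ0 hβ2 hT hu hv hS huS hvS
  have hlim : Tendsto (fun k : ℕ => M * (1 / 2) ^ k * Real.exp (γ * t)) atTop (𝓝 0) := by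
    simpa using ((tendsto_pow_atTop_nhds_zero_of_lt_one (r := (1 / 2 : ℝ)) (by norm_num)
      (by norm_num)).const_mul M).mul_const (Real.exp (γ * t))
  refine AEEqFun.ext ?_
  filter_upwards [ae_all_iff.2 fun k => h k t ht] with x hx
  exact sub_eq_zero.1 (abs_nonpos_iff.1 (ge_of_tendsto' hlim hx))

theorem unique {C lam : ℝ} (hβ0 : 0 < β) (hβ2 : β ≤ 2) (hf : ExpGrowth p C lam f) (hT : T ≤ 1)
    (hu : IsMildSolution p β f u₀ T u) (hv : IsMildSolution p β f u₀ T v) {t : ℝ}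
    (ht : t ∈ Icc 0 T) : u t = v t := by
  have := isProbabilityMeasure_stableLaw (n := n) hβ0 hβ2
  obtain ⟨c, hP⟩ := exists_stableLaw_le (n := n) hβ0
  obtain ⟨μ, θ, hμ, hbound⟩ := hf.exists_smoothingBound hP hβ0
  obtain ⟨B, hB⟩ := hu.curve.exists_mem_expBall hf.exponent_pos hμ
  obtain ⟨B', hB'⟩ := hv.curve.exists_mem_expBall hf.exponent_pos hμ
  obtain ⟨Λ, K, hS⟩ := hbound (max B B')
  exact eq_of_mem_smoothingBound hβ0 hβ2 hT hu hv hS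
    (fun s hs => expBall_mono (le_max_left _ _) (hB s hs))
    (fun s hs => expBall_mono (le_max_right _ _) (hB' s hs)) ht

end IsMildSolution

end Uniqueness

/-! ### Existence -/

lemma exists_small_time {θ : ℝ} (hθ : θ < 1) (Λ K : ℝ) :
    ∃ T : ℝ, 0 < T ∧ T ≤ 1 ∧ Λ * (T ^ (1 - θ) / (1 - θ)) ≤ 1 / 2 ∧ T * K ≤ 1 := by
  have hsup : Tendsto (fun T : ℝ => Λ * (T ^ (1 - θ) / (1 - θ))) (𝓝 0) (𝓝 0) := by
    have hθ' : 0 < 1 - θ := sub_pos.2 hθ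
    exact (((Real.continuous_rpow_const hθ'.le).div_const _).const_mul Λ).tendsto' _ _
      (by simp [Real.zero_rpow hθ'.ne'])
  have hlp : Tendsto (fun T : ℝ => T * K) (𝓝 0) (𝓝 0) :=
    (continuous_mul_const K).tendsto' _ _ (zero_mul K)
  have hsmall := (eventually_le_nhds (one_pos (α := ℝ))).and
    ((hsup.eventually_le_const (by norm_num : (0 : ℝ) < 1 / 2)).and
      (hlp.eventually_le_const one_pos))
  obtain ⟨T, hT0, hT⟩ :=
    ((eventually_mem_nhdsWithin (s := Ioi 0)).and (hsmall.filter_mono nhdsWithin_le_nhds)).exists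
  exact ⟨T, hT0, hT⟩

lemma duhamelMap_eq_intervalIntegral {V : Type*} [NormedAddCommGroup V] [InnerProductSpace ℝ V]
    [MeasurableSpace V] {P : Measure V} {β T t : ℝ} {f : ℝ → ℝ} {a w : ℝ × V → ℝ}
    (ht : t ∈ Icc 0 T) (x : V) :
    duhamelMap P β f T a w (t, x) =
      ∫ s in (0 : ℝ)..t, avg P ((t - s) ^ (1 / β)) (source f T a w s) x := by
  have hzero : ∀ σ ∈ Ioc 0 T \ Ioc 0 t,
      avg P (σ ^ (1 / β)) (source f T a w (t - σ)) x = 0 := fun σ hσ => by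
    have : t < σ := not_le.1 fun h => hσ.2 ⟨hσ.1.1, h⟩
    rw [source_of_notMem fun h => by linarith [h.1]]
    simp only [avg, integral_zero]
  rw [duhamelMap, setIntegral_eq_of_subset_of_forall_sdiff_eq_zero measurableSet_Ioc
    (Ioc_subset_Ioc_right ht.2) hzero, ← intervalIntegral_comp_sub_left_eq_setIntegral ht.1]
  simp only [sub_sub_cancel]

section Picard

variable {V : Type*} [NormedAddCommGroup V] [InnerProductSpace ℝ V] [FiniteDimensional ℝ V]
  [MeasurableSpace V] [BorelSpace V] {P : Measure V} {β p μ T θ : ℝ} {f : ℝ → ℝ}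
  {S : Set (V → ℝ)} {Λ K c : ℝ≥0} {u : V → ℝ} {a w : ℝ × V → ℝ}

/-- The free evolution `S(t) u` at `(t, x)`. -/
def freeEvolution (P : Measure V) (β : ℝ) (u : V → ℝ) (y : ℝ × V) : ℝ :=
  avg P (y.1 ^ (1 / β)) u y.2

lemma measurable_freeEvolution [SFinite P] (hu : Measurable u) :
    Measurable (freeEvolution P β u) :=
  measurable_avg (g := fun _ : ℝ × V => u) (hu.comp measurable_snd) (by fun_prop) measurable_snd

lemma measurable_freeEvolution_add [SFinite P] (hu : Measurable u) (hw : Measurable w) (t : ℝ) :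
    Measurable fun x => freeEvolution P β u (t, x) + w (t, x) :=
  ((measurable_freeEvolution hu).add hw).comp measurable_prodMk_left

lemma expInt_freeEvolution_add_le [IsProbabilityMeasure P] (hp : 1 ≤ p) (hμ : 0 ≤ μ)
    (hu : Measurable u) (hw : Admissible p w) (t : ℝ) :
    expInt p μ (fun x => freeEvolution P β u (t, x) + w (t, x)) ≤
      ENNReal.ofReal (Real.exp (μ * 2 ^ p)) *
        (expInt p (μ * 2 ^ p) u + ENNReal.ofReal (μ * 2 ^ p)) := by
  have h := expInt_add_le_of_abs_le (p := p) (ν := volume) (by linarith) hμ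
    (measurable_avg_right (P := P) (t ^ (1 / β)) hu) fun x => hw.abs_le_one (t, x)
  rw [Real.one_rpow, mul_one] at h
  refine h.trans ?_
  gcongr
  · exact expInt_avg_le hp (by positivity) hu _
  · exact mul_le_of_le_one_right' (hw.lpInt_le_one t)

lemma isHeart_freeEvolution_add [IsProbabilityMeasure P] (hp : 1 ≤ p) (hu : Measurable u)
    (hh : IsHeart p u) (hw : Admissible p w) (t : ℝ) :
    IsHeart p fun x => freeEvolution P β u (t, x) + w (t, x) := fun μ hμ => by
  have := hh (μ * 2 ^ p) (by positivity)
  exact ne_top_of_le_ne_top (by finiteness) (expInt_freeEvolution_add_le hp hμ.le hu hw t)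

lemma exists_picardData [IsProbabilityMeasure P] {C lam : ℝ} (hf : ExpGrowth p C lam f)
    (hP : P ≤ (c : ℝ≥0∞) • volume) (hβ : 0 < β) (hu : Measurable u) (hh : IsHeart p u) :
    ∃ S θ Λ K T, PicardData P β p f S θ Λ K T (freeEvolution P β u) := by
  obtain ⟨μ, θ, hμ, hbound⟩ := hf.exists_smoothingBound hP hβ
  have hfin : ENNReal.ofReal (Real.exp (μ * 2 ^ p)) *
      (expInt p (μ * 2 ^ p) u + ENNReal.ofReal (μ * 2 ^ p)) ≠ ⊤ := by
    have := hh (μ * 2 ^ p) (by positivity)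
    finiteness
  obtain ⟨Λ, K, hS⟩ := hbound (ENNReal.toNNReal _)
  obtain ⟨T, hT0, hT1, hsup, hlp⟩ := exists_small_time hS.exponent_lt Λ K
  exact ⟨_, θ, Λ, K, T,
    { bound := hS
      measurable := measurable_freeEvolution hu
      add_mem := fun w hw s => ⟨measurable_freeEvolution_add hu hw.measurable s,
        (expInt_freeEvolution_add_le hf.one_le hμ.le hu hw s).trans_eq
          (ENNReal.coe_toNNReal hfin).symm⟩
      time_pos := hT0
      time_le_one := hT1
      sup_small := hsup
      lpInt_small := hlp }⟩

lemma tendsto_expInt_freeEvolution_sub [IsProbabilityMeasure P] (hP : P ≤ (c : ℝ≥0∞) • volume)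
    (hp : 1 ≤ p) (hβ : 0 < β) (hμ : 0 < μ) (hu : Measurable u) (hh : IsHeart p u) (t₀ : ℝ) :
    Tendsto (fun t => expInt p μ fun x => freeEvolution P β u (t, x) - freeEvolution P β u (t₀, x))
      (𝓝 t₀) (𝓝 0) := by
  have hdil : Tendsto (fun t : ℝ => t ^ (1 / β)) (𝓝 t₀) (𝓝 (t₀ ^ (1 / β))) :=
    (Real.continuous_rpow_const (by positivity)).tendsto t₀
  simpa only [freeEvolution, Function.comp_def] using
    (tendsto_expInt_avg_sub hP hp hμ hu hh (t₀ ^ (1 / β))).comp hdil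

lemma PicardData.tendsto_expInt_sub_of_fixedPoint [IsProbabilityMeasure P]
    (D : PicardData P β p f S θ Λ K T a) (hP : P ≤ (c : ℝ≥0∞) • volume) (hp : 1 ≤ p)
    (hμ : 0 ≤ μ) (hw : Admissible p w) (hfix : duhamelMap P β f T a w = w) (t₀ : ℝ) :
    Tendsto (fun t => expInt p μ fun x => w (t, x) - w (t₀, x)) (𝓝 t₀) (𝓝 0) := by
  have hbound (t : ℝ) (x : V) : |w (t, x) - w (t₀, x)| ≤ 2 :=
    (abs_sub _ _).trans (by linarith [hw.abs_le_one (t, x), hw.abs_le_one (t₀, x)])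
  have hlp := D.tendsto_lpInt_duhamelMap_sub hP hp hw t₀
  rw [hfix] at hlp
  exact tendsto_expInt_of_tendsto_lpInt (by linarith) hμ hbound hlp

lemma PicardData.tendsto_expInt_freeEvolution_add_sub [IsProbabilityMeasure P]
    (D : PicardData P β p f S θ Λ K T (freeEvolution P β u)) (hP : P ≤ (c : ℝ≥0∞) • volume)
    (hp : 1 ≤ p) (hβ : 0 < β) (hμ : 0 < μ) (hu : Measurable u) (hh : IsHeart p u)
    (hw : Admissible p w) (hfix : duhamelMap P β f T (freeEvolution P β u) w = w) (t₀ : ℝ) :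
    Tendsto (fun t => expInt p μ fun x => (freeEvolution P β u (t, x) + w (t, x)) -
      (freeEvolution P β u (t₀, x) + w (t₀, x))) (𝓝 t₀) (𝓝 0) := by
  have hμ' : 0 < μ * 2 ^ p := by positivity
  have hsum := (tendsto_expInt_freeEvolution_sub hP hp hβ hμ' hu hh t₀).add
    (D.tendsto_expInt_sub_of_fixedPoint hP hp hμ'.le hw hfix t₀)
  rw [add_zero] at hsum
  have hmeas (t : ℝ) : Measurable fun x => freeEvolution P β u (t, x) :=
    (measurable_freeEvolution hu).comp measurable_prodMk_left
  refine tendsto_of_tendsto_of_tendsto_of_le_of_le tendsto_const_nhds hsum (fun _ => zero_le)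
    fun t => ?_
  simp only [add_sub_add_comm]
  exact expInt_add_le (by linarith) hμ.le ((hmeas t).sub (hmeas t₀)) fun x => w (t, x) - w (t₀, x)

lemma PicardData.intervalIntegrable_avg_source [SFinite P] (D : PicardData P β p f S θ Λ K T a)
    (hw : Admissible p w) {t : ℝ} (ht : t ∈ Icc 0 T) (x : V) :
    IntervalIntegrable (fun s => avg P ((t - s) ^ (1 / β)) (source f T a w s) x) volume 0 t := by
  simpa only [sub_sub_cancel] using intervalIntegrable_comp_sub_left ht.1
    ((D.integrableOn_avg_source hw t x).mono_set (Ioc_subset_Ioc_right ht.2))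

lemma avg_source_ae_eq (hP : P ≤ (c : ℝ≥0∞) • volume) {U : ℝ → V → ℝ}
    (hU : ∀ s, ∀ᵐ y, U s y = a (s, y) + w (s, y)) {t : ℝ} (ht : t ∈ Icc 0 T) (x : V) :
    ∀ᵐ s : ℝ, s ∈ uIoc 0 t → avg P ((t - s) ^ (1 / β)) (source f T a w s) x =
      avg P ((t - s) ^ (1 / β)) (fun y => f (U s y)) x := by
  filter_upwards [Measure.ae_ne volume t] with s hst hs
  rw [uIoc_of_le ht.1] at hs
  have hts : 0 < t - s := sub_pos.2 (hs.2.lt_of_ne hst)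
  rw [source_of_mem (Ioc_subset_Ioc_right ht.2 hs)]
  refine integral_congr_ae ?_
  filter_upwards [ae_sub_smul hP (hU s) (Real.rpow_pos_of_pos hts _).ne' x] with z hz
  rw [hz]

end Picard

theorem PicardData.isMildSolution {n : ℕ} {p β θ T : ℝ} {f : ℝ → ℝ} {S : Set (E n → ℝ)}
    {Λ K : ℝ≥0} {u₀ : Fn n} {w : ℝ × E n → ℝ}
    (D : PicardData (stableLaw n β) β p f S θ Λ K T (freeEvolution (stableLaw n β) β u₀))
    (hp : 1 ≤ p) (hβ0 : 0 < β) (hβ2 : β ≤ 2) (hu₀ : u₀ ∈ expLZero n p) (hw : Admissible p w)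
    (hfix : duhamelMap (stableLaw n β) β f T (freeEvolution (stableLaw n β) β u₀) w = w)
    {u : ℝ → Fn n}
    (hu : ∀ t, ∀ᵐ x, u t x = freeEvolution (stableLaw n β) β u₀ (t, x) + w (t, x)) :
    IsMildSolution p β f u₀ T u := by
  have hp0 : 0 < p := by linarith
  have := isProbabilityMeasure_stableLaw (n := n) hβ0 hβ2
  obtain ⟨c, hP⟩ := exists_stableLaw_le (n := n) hβ0
  have hh : IsHeart p u₀ := isHeart_of_mem_expLZero hp0 hu₀
  refine ⟨⟨fun t _ => mem_expLZero_of_isHeart hp fun μ hμ => ?_,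
    fun t₀ _ => (tendsto_luxNorm_zero_iff hp0).2 fun μ hμ => ?_⟩, fun t ht => ?_⟩
  · rw [expInt_congr (hu t)]
    exact isHeart_freeEvolution_add hp u₀.measurable hh hw t μ hμ
  · have hlim := D.tendsto_expInt_freeEvolution_add_sub hP hp hβ0 hμ u₀.measurable hh hw hfix t₀
    filter_upwards [(hlim.eventually_le_const one_pos).filter_mono nhdsWithin_le_nhds] with t ht
    have hsub : ∀ᵐ x, u t x - u t₀ x = (freeEvolution (stableLaw n β) β u₀ (t, x) + w (t, x)) -
        (freeEvolution (stableLaw n β) β u₀ (t₀, x) + w (t₀, x)) := by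
      filter_upwards [hu t, hu t₀] with x h h₀
      rw [h, h₀]
    rwa [expInt_congr hsub]
  · filter_upwards [hu t] with x hx
    have hsource : ∀ᵐ s : ℝ, s ∈ uIoc 0 t →
        avg (stableLaw n β) ((t - s) ^ (1 / β))
            (source f T (freeEvolution (stableLaw n β) β u₀) w s) x =
          semigroup β (t - s) (fun y => f (u s y)) x := by
      filter_upwards [avg_source_ae_eq (β := β) hP hu ht x] with s h hs
      rw [semigroup_eq_avg hβ0 hβ2 (sub_nonneg.2 (uIoc_of_le ht.1 ▸ hs).2), h hs]
    refine ⟨(D.intervalIntegrable_avg_source hw ht x).congr_ae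
      ((ae_restrict_iff' measurableSet_uIoc).2 hsource), ?_⟩
    rw [hx, ← intervalIntegral.integral_congr_ae hsource, semigroup_eq_avg hβ0 hβ2 ht.1,
      ← duhamelMap_eq_intervalIntegral ht, hfix]
    rfl

theorem exists_isMildSolution {n : ℕ} {p β C lam : ℝ} {f : ℝ → ℝ} (hβ0 : 0 < β) (hβ2 : β ≤ 2)
    (hf : ExpGrowth p C lam f) {u₀ : Fn n} (hu₀ : u₀ ∈ expLZero n p) :
    ∃ T : ℝ, 0 < T ∧ T ≤ 1 ∧ ∃ u, IsMildSolution p β f u₀ T u := by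
  have := isProbabilityMeasure_stableLaw (n := n) hβ0 hβ2
  obtain ⟨c, hP⟩ := exists_stableLaw_le (n := n) hβ0
  obtain ⟨S, θ, Λ, K, T, D⟩ := exists_picardData hf hP hβ0 u₀.measurable
    (isHeart_of_mem_expLZero hf.exponent_pos hu₀)
  obtain ⟨w, hw, hfix⟩ := D.exists_fixedPoint hf.one_le
  exact ⟨T, D.time_pos, D.time_le_one,
    fun t => AEEqFun.mk _
      (measurable_freeEvolution_add u₀.measurable hw.measurable t).aestronglyMeasurable,
    D.isMildSolution hf.one_le hβ0 hβ2 hu₀ hw hfix fun t => AEEqFun.coeFn_mk _ _⟩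

theorem theorem1_general {n : ℕ} {p β : ℝ} (hp : 1 ≤ p) (hβ0 : 0 < β) (hβ2 : β ≤ 2)
    {f : ℝ → ℝ} {C lam : ℝ} (hC : 0 < C) (hlam : 0 < lam) (hf0 : f 0 = 0)
    (hf : ∀ a b : ℝ, |f a - f b| ≤
      C * |a - b| * (Real.exp (lam * |a| ^ p) + Real.exp (lam * |b| ^ p)))
    {u₀ : Fn n} (hu₀ : u₀ ∈ expLZero n p) :
    ∃ T : ℝ, 0 < T ∧ ∃ u : ℝ → Fn n, IsMildSolution p β f u₀ T u ∧
      ∀ v : ℝ → Fn n, IsMildSolution p β f u₀ T v → ∀ t ∈ Icc 0 T, v t = u t := by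
  have hgrowth : ExpGrowth p C lam f := ⟨hp, hC, hlam, hf0, hf⟩
  obtain ⟨T, hT0, hT1, u, hu⟩ := exists_isMildSolution hβ0 hβ2 hgrowth hu₀
  exact ⟨T, hT0, u, hu, fun v hv t ht => hv.unique hβ0 hβ2 hgrowth hT1 hu ht⟩

end FracHeat

end

theorem theorem1 (n : ℕ) (hn : 1 ≤ n) (p β : ℝ) (hp : 1 < p) (hβ0 : 0 < β) (hβ2 : β < 2)
    (f : ℝ → ℝ) (C lam : ℝ) (hC : 0 < C) (hlam : 0 < lam) (hf0 : f 0 = 0)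
    (hf : ∀ a b : ℝ, |f a - f b| ≤
      C * |a - b| * (Real.exp (lam * |a| ^ p) + Real.exp (lam * |b| ^ p)))
    (u₀ : FracHeat.Fn n) (hu₀ : u₀ ∈ FracHeat.expLZero n p) :
    ∃ T : ℝ, 0 < T ∧ ∃ u : ℝ → FracHeat.Fn n,
      FracHeat.IsMildSolution p β f u₀ T u ∧
      ∀ v : ℝ → FracHeat.Fn n, FracHeat.IsMildSolution p β f u₀ T v →
        ∀ t ∈ Set.Icc 0 T, v t = u t :=
  FracHeat.theorem1_general hp.le hβ0 hβ2.le hC hlam hf0 hf hu₀
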